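/- **Setting.** Let $d\ge 1$ and let $\Omega\subset\mathbb R^d$ be a bounded open set with Lipschitz boundary. Let $\varepsilon>0$, $\mathbf b\in W^{1,\infty}(\Omega)^d$, $c\in L^\infty(\Omega)$ with $c\ge 0$, $g\in L^2(\Omega)$, and assume that for some constant $\sigma_0>0$ $$c-\tfrac12\nabla\cdot\mathbf b\ \ge\ \sigma_0\quad\text{a.e. in }\Omega .$$ Put $a(u,v)=\varepsilon(\nabla u,\nabla v)_\Omega+(\mathbf b\cdot\nabla u,v)_\Omega+(cu,v)_\Omega$. **Mesh and spaces.** Let $\mathcal T_h$ be a finite conforming mesh of $\overline\Omega$, that is, a decomposition into non-overlapping closed elements any two of which meet in a common (possibly empty) face. Each element $K_e=F_e(\hat K_e)$ is the image of the unit simplex under an affine map, or of the unit cube under a multilinear map, where $F_e$ is injective with nonvanishing Jacobian determinant on $\hat K_e$. Let $p\ge1$, and let $V_h(K_e)$ consist of the functions $q\circ F_e^{-1}$ with $q$ a polynomial of total degree $\le p$ (simplex) or of degree $\le p$ in each variable (cube). Let $$V_h=\{v\in C(\overline\Omega): v|_{K_e}\in V_h(K_e)\ \forall K_e\in\mathcal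 T_h\},\qquad V_{h,0}=V_h\cap H^1_0(\Omega).$$ **Fluctuation operator.** Let $\varphi_a\in V_h$ be the Lagrange basis function of the node $a$, where the nodes are the images under the maps $F_e$ of the points of $\hat K_e$ with coordinates in $\{0,1/p,\dots,1\}$. For each node $a$ choose an element $K_a\ni a$, and let $\psi_a\in V_h(K_a)$ be the dual function with $\int_{K_a}\psi_a\varphi_{a'}\,dx=\delta_{aa'}$ for all nodes $a'\in K_a$. The Scott–Zhang operator is $P_hv=\sum_a\big(\int_{K_a}\psi_a v\,dx\big)\varphi_a$ for $v\in L^2(\Omega)$; it acts componentwise on vector fields. Put $\kappa_e G=(G-P_hG)|_{K_e}$ for $G\in L^2(\Omega)^d$. **Stabilization.** Let $\Omega_e$ be the patch (interior of the union) of all elements sharing a vertex with $K_e$, including $K_e$. Let $\omega_e$ be the largest number in $(0,1]$ such that $\|\kappa_e\nabla v\|_{0,K_e}\le C\|\nabla v\|_{0,\Omega_e}$ for all $v\in H^1(\Omega_e)$ holds for every $C\ge1/\sqrt{\omega_e}$. (As $\kappa_e G$ depends only on $G|_{\Omega_e}$, $\nabla v$ may be extended to $\Omega$ by any $L^2$ field.)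 Let $\nu_e=\|\mathbf b\|_{L^\infty(K_e)}\,\mathrm{diam}(K_e)/(2p)$, and let $\gamma_e:V_h\to[0,1]$ be given blending factors. For $u,w,v\in V_h$ define $$s_h(w,v)=\sum_e\omega_e\nu_e(\kappa_e\nabla v,\kappa_e\nabla w)_{K_e},$$ $$d_h(u;w,v)=\sum_e(1-\gamma_e(u))\nu_e\Big((\nabla v,\nabla w)_{\Omega_e}-\omega_e(\kappa_e\nabla v,\kappa_e\nabla w)_{K_e}\Big)+\sum_e\gamma_e(u)\nu_e(1-\omega_e)(\kappa_e\nabla v,\kappa_e\nabla w)_{K_e}.$$ **Theorem.** If $\gamma_e:V_h\to[0,1]$ is continuous for every $K_e\in\mathcal T_h$, then for every $u_{h,D}\in V_h$ there exists $u_h\in V_h$ with $u_h-u_{h,D}\in V_{h,0}$ and $$a(u_h,v_h)+s_h(u_h,v_h)+d_h(u_h;u_h,v_h)=(g,v_h)_\Omega\qquad\forall v_h\in V_{h,0}.$$ -/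

import Mathlib

open MeasureTheory Set Filter Topology
open scoped ENNReal ContDiff

noncomputable section

/-- Euclidean space `ℝ^d`. -/
abbrev Euc (d : ℕ) := EuclideanSpace ℝ (Fin d)

/-! ### Domains and Sobolev spaces -/

/-- Lipschitz boundary: near every boundary point, `Ω` is the strict epigraph, in some direction
`n`, of a Lipschitz function `f` of the coordinates orthogonal to `n`. -/
def HasLipschitzBoundary {d : ℕ} (Ω : Set (Euc d)) : Prop :=
  ∀ x ∈ frontier Ω, ∃ (n : Euc d) (r : ℝ) (L : NNReal) (f : Euc d → ℝ),
    ‖n‖ = 1 ∧ 0 < r ∧ LipschitzWith L f ∧ (∀ y (t : ℝ), f (y + t • n) = f y) ∧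
      ∀ y ∈ Metric.ball x r, (y ∈ Ω ↔ f y < inner ℝ n y)

/-- `φ ∈ C_c^∞(U)`. -/
def IsTestFun {d : ℕ} (U : Set (Euc d)) (φ : Euc d → ℝ) : Prop :=
  ContDiff ℝ ∞ φ ∧ HasCompactSupport φ ∧ tsupport φ ⊆ U

/-- `G` is a weak (distributional) gradient of `v` on the open set `U`. -/
def IsWeakGradient {d : ℕ} (U : Set (Euc d)) (v : Euc d → ℝ) (G : Euc d → Euc d) : Prop :=
  ∀ φ, IsTestFun U φ → ∀ i : Fin d,
    ∫ x in U, v x * gradient φ x i = -∫ x in U, G x i * φ x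

/-- `v ∈ H^1(U)` with weak gradient `G`. -/
def IsH1 {d : ℕ} (U : Set (Euc d)) (v : Euc d → ℝ) (G : Euc d → Euc d) : Prop :=
  MemLp v 2 (volume.restrict U) ∧ MemLp G 2 (volume.restrict U) ∧ IsWeakGradient U v G

/-- `v ∈ H^1_0(U)`, the closure of `C_c^∞(U)` in `H^1(U)`. -/
def IsH10 {d : ℕ} (U : Set (Euc d)) (v : Euc d → ℝ) : Prop :=
  ∃ G : Euc d → Euc d, IsH1 U v G ∧
    ∃ φ : ℕ → Euc d → ℝ, (∀ n, IsTestFun U (φ n)) ∧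
      Tendsto (fun n => eLpNorm (fun x => v x - φ n x) 2 (volume.restrict U)) atTop (𝓝 0) ∧
      Tendsto (fun n => eLpNorm (fun x => G x - gradient (φ n) x) 2 (volume.restrict U))
        atTop (𝓝 0)

/-- `b ∈ W^{1,∞}(U)^d`, where `Db i` is the weak gradient of the component `b_i`. -/
def IsW1inf {d : ℕ} (U : Set (Euc d)) (b : Euc d → Euc d) (Db : Fin d → Euc d → Euc d) : Prop :=
  MemLp b ∞ (volume.restrict U) ∧
    ∀ i, MemLp (Db i) ∞ (volume.restrict U) ∧ IsWeakGradient U (fun x => b x i) (Db i)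

/-- The divergence `∑ i, ∂_i b_i`, from the weak gradients `Db i` of the components. -/
def weakDiv {d : ℕ} (Db : Fin d → Euc d → Euc d) (x : Euc d) : ℝ := ∑ i, Db i x i

/-- The norm `‖G‖_{0,A}` of `L^2(A)^d`. -/
def normL2 {d : ℕ} (A : Set (Euc d)) (G : Euc d → Euc d) : ℝ :=
  √(∫ x in A, ‖G x‖ ^ 2)

/-- The inner product `(G, H)_A` of `L^2(A)^d`. -/
def innerL2 {d : ℕ} (A : Set (Euc d)) (G H : Euc d → Euc d) : ℝ :=
  ∫ x in A, inner ℝ (G x) (H x)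

/-! ### Elements and meshes -/

/-- The two types of elements: simplices (with `ℙ_p`) and quadrilaterals / hexahedra
(with `ℚ_p`). -/
inductive CellShape
  | simplex
  | cube

/-- The reference element: the unit simplex or the unit cube of `ℝ^d`. -/
def refCell (d : ℕ) : CellShape → Set (Fin d → ℝ)
  | .simplex => {ξ | (∀ i, 0 ≤ ξ i) ∧ ∑ i, ξ i ≤ 1}
  | .cube => {ξ | ∀ i, 0 ≤ ξ i ∧ ξ i ≤ 1}

/-- Polynomials on the reference element: `ℙ_p` (total degree at most `p`) on the simplex, `ℚ_p`
(degree at most `p` in each variable) on the cube. -/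
def polySpace (d : ℕ) : CellShape → ℕ → Submodule ℝ (MvPolynomial (Fin d) ℝ)
  | .simplex, p => MvPolynomial.restrictTotalDegree (Fin d) ℝ p
  | .cube, p => MvPolynomial.restrictDegree (Fin d) ℝ p

open Classical in
/-- The Lagrange nodes of degree `p` of the reference element: its points with coordinates in
`{0, 1/p, …, 1}`. For `p = 1` these are its vertices. -/
def refNodes (d : ℕ) (s : CellShape) (p : ℕ) : Finset (Fin d → ℝ) :=
  (Finset.univ.image fun (α : Fin d → Fin (p + 1)) (i : Fin d) => ((α i : ℕ) : ℝ) / (p : ℝ)).filter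
    (· ∈ refCell d s)

/-- The map `ℝ^d → ℝ^d` with polynomial components `F`. -/
def polyMap {d : ℕ} (F : Fin d → MvPolynomial (Fin d) ℝ) (ξ : Fin d → ℝ) : Euc d :=
  WithLp.toLp 2 fun i => MvPolynomial.eval ξ (F i)

/-- An element: the image of a reference element under an injective map with nonvanishing Jacobian
determinant which is affine (simplices) or multilinear (quadrilaterals and hexahedra). -/
structure FECell (d : ℕ) where
  shape : CellShape
  geo : Fin d → MvPolynomial (Fin d) ℝ
  geo_mem : ∀ i, geo i ∈ polySpace d shape 1
  injOn : InjOn (polyMap geo) (refCell d shape)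
  jacobian_ne_zero : ∀ ξ ∈ refCell d shape,
    (Matrix.of fun i j => MvPolynomial.eval ξ (MvPolynomial.pderiv j (geo i))).det ≠ 0

namespace FECell

variable {d : ℕ} (K : FECell d)

/-- The reference map `F_K`. -/
def map : (Fin d → ℝ) → Euc d := polyMap K.geo

/-- The (closed) set of points of the element. -/
def pts : Set (Euc d) := K.map '' refCell d K.shape

open Classical in
/-- The Lagrange nodes of degree `p` of the element. -/
def nodes (p : ℕ) : Finset (Euc d) := (refNodes d K.shape p).image K.map

/-- The vertices of the element. -/
def vertices : Finset (Euc d) := K.nodes 1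

/-- Functions that belong to the local space `V_h(K)` on `K`, i.e. whose restriction to `K` is
`q ∘ F_K⁻¹` with `q` in `ℙ_p` or `ℚ_p`. (The values outside `K` play no role.) -/
def localSpace (p : ℕ) : Set (Euc d → ℝ) :=
  {f | ∃ q ∈ polySpace d K.shape p, ∀ ξ ∈ refCell d K.shape, f (K.map ξ) = MvPolynomial.eval ξ q}

/-- Faces of an element (of any dimension, including `∅` and the element itself): the images of
the faces of the reference element. -/
def IsFace (S : Set (Euc d)) : Prop :=
  ∃ R : Set (Fin d → ℝ), IsExposed ℝ (refCell d K.shape) R ∧ S = K.map '' R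

end FECell

/-- A mesh of `Ω`: a finite conforming decomposition of the closure of `Ω` into non-overlapping
elements. -/
structure FEMesh {d : ℕ} (Ω : Set (Euc d)) (ι : Type*) [Fintype ι] where
  cell : ι → FECell d
  cover : ⋃ e, (cell e).pts = closure Ω
  nonoverlap : ∀ e e', e ≠ e' → Disjoint (interior (cell e).pts) (interior (cell e').pts)
  conforming : ∀ e e', e ≠ e' → (cell e).IsFace ((cell e).pts ∩ (cell e').pts)

/-- Extension by zero of a function on the closure of `Ω`. -/
def extZero {d : ℕ} {Ω : Set (Euc d)} (u : C(closure Ω, ℝ)) : Euc d → ℝ :=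
  Function.extend Subtype.val u 0

theorem extZero_apply {d : ℕ} {Ω : Set (Euc d)} (u : C(closure Ω, ℝ)) {x : Euc d}
    (hx : x ∈ closure Ω) : extZero u x = u ⟨x, hx⟩ :=
  Subtype.val_injective.extend_apply u 0 ⟨x, hx⟩

/-- The gradient `∇u`, computed classically in the interior of the elements (hence almost
everywhere). -/
def grad {d : ℕ} {Ω : Set (Euc d)} (u : C(closure Ω, ℝ)) : Euc d → Euc d := gradient (extZero u)

namespace FEMesh

variable {d : ℕ} {Ω : Set (Euc d)} {ι : Type*} [Fintype ι] (T : FEMesh Ω ι) (p : ℕ)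

theorem map_mem_closure (e : ι) {ξ : Fin d → ℝ} (hξ : ξ ∈ refCell d (T.cell e).shape) :
    (T.cell e).map ξ ∈ closure Ω := by
  rw [← T.cover]
  exact mem_iUnion.2 ⟨e, mem_image_of_mem _ hξ⟩

/-- The finite element space `V_h = {v ∈ C(Ω̄) : v|_K ∈ V_h(K) for all elements K}`. -/
def space : Submodule ℝ C(closure Ω, ℝ) where
  carrier := {u | ∀ e, extZero u ∈ (T.cell e).localSpace p}
  add_mem' := by
    intro u v hu hv e
    obtain ⟨q, hq, h⟩ := hu e
    obtain ⟨q', hq', h'⟩ := hv e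
    refine ⟨q + q', add_mem hq hq', fun ξ hξ => ?_⟩
    have hx := T.map_mem_closure e hξ
    rw [map_add, ← h ξ hξ, ← h' ξ hξ, extZero_apply _ hx, extZero_apply _ hx, extZero_apply _ hx]
    rfl
  zero_mem' := by
    intro e
    refine ⟨0, zero_mem _, fun ξ hξ => ?_⟩
    rw [extZero_apply _ (T.map_mem_closure e hξ), map_zero]
    rfl
  smul_mem' := by
    intro c u hu e
    obtain ⟨q, hq, h⟩ := hu e
    refine ⟨c • q, Submodule.smul_mem _ c hq, fun ξ hξ => ?_⟩
    have hx := T.map_mem_closure e hξ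
    rw [MvPolynomial.smul_eval, ← h ξ hξ, extZero_apply _ hx, extZero_apply _ hx]
    rfl

/-- `V_{h,0} = V_h ∩ H^1_0(Ω)`. -/
def space0 : Set C(closure Ω, ℝ) := {v | v ∈ T.space p ∧ IsH10 Ω (extZero v)}

open Classical in
/-- The Lagrange nodes of the mesh. -/
def nodes : Finset (Euc d) := Finset.univ.biUnion fun e => (T.cell e).nodes p

open Classical in
/-- The Lagrange basis function `φ_a ∈ V_h` of the node `a`: it is `1` at `a` and `0` at all other
nodes. -/
def nodal (a : Euc d) : C(closure Ω, ℝ) :=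
  if h : ∃ φ ∈ T.space p, ∀ a' ∈ T.nodes p, extZero φ a' = if a' = a then 1 else 0 then h.choose
  else 0

open Classical in
/-- The dual function `ψ_a ∈ V_h(K_e)` of a node `a`: `∫_{K_e} ψ_a φ_{a'} = δ_{a a'}` for all
nodes `a'` of `K_e`. -/
def dual (e : ι) (a : Euc d) : Euc d → ℝ :=
  if h : ∃ ψ ∈ (T.cell e).localSpace p, ∀ a' ∈ (T.cell e).nodes p,
      ∫ x in (T.cell e).pts, ψ x * extZero (T.nodal p a') x = if a' = a then 1 else 0 then h.choose
  else 0

/-- The `L^2`-stable Scott-Zhang operator `P_h : L^2(Ω) → V_h`,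
`P_h v = ∑_a (∫_{K_a} ψ_a v) φ_a`, for a choice `a ↦ K_a` of an element containing the node. -/
def scottZhang (sel : Euc d → ι) (v : Euc d → ℝ) : C(closure Ω, ℝ) :=
  ∑ a ∈ T.nodes p, (∫ x in (T.cell (sel a)).pts, T.dual p (sel a) a x * v x) • T.nodal p a

/-- The fluctuation operator `κ G = G - P_h G`, with `P_h` acting componentwise. -/
def fluct (sel : Euc d → ι) (G : Euc d → Euc d) (x : Euc d) : Euc d :=
  WithLp.toLp 2 fun i => G x i - extZero (T.scottZhang p sel fun y => G y i) x

/-- The (open) patch `Ω_e` of all elements that share a vertex with `K_e` (including `K_e`). -/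
def patch (e : ι) : Set (Euc d) :=
  interior (⋃ e' ∈ {e' | ∃ a, a ∈ (T.cell e).vertices ∧ a ∈ (T.cell e').vertices}, (T.cell e').pts)

/-- The constant `ω_e`: the largest `w ∈ (0, 1]` such that
`‖κ_e ∇v‖_{0,K_e} ≤ C ‖∇v‖_{0,Ω_e}` for all `v ∈ H^1(Ω_e)` holds for all `C ≥ 1/√w`.
As `κ_e` acts on `L^2(Ω)^d`, `G` is any `L^2` extension of `∇v` to `Ω`; since `κ_e G` only depends
on the values of `G` in `Ω_e`, the extension does not matter. -/
def stabConst (sel : Euc d → ι) (e : ι) : ℝ :=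
  sSup {w : ℝ | 0 < w ∧ w ≤ 1 ∧ ∀ C : ℝ, 1 / √w ≤ C →
    ∀ (v : Euc d → ℝ) (G : Euc d → Euc d), MemLp G 2 (volume.restrict Ω) → IsH1 (T.patch e) v G →
      normL2 (T.cell e).pts (T.fluct p sel G) ≤ C * normL2 (T.patch e) G}

/-- The artificial viscosity `ν_e = ‖b‖_{L^∞(K_e)} h_e / (2p)`. -/
def visc (b : Euc d → Euc d) (e : ι) : ℝ :=
  (eLpNorm b ∞ (volume.restrict (T.cell e).pts)).toReal * Metric.diam (T.cell e).pts / (2 * p)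

/-- `(κ_e ∇v, κ_e ∇w)_{K_e}`. -/
def fluctForm (sel : Euc d → ι) (e : ι) (v w : C(closure Ω, ℝ)) : ℝ :=
  innerL2 (T.cell e).pts (T.fluct p sel (grad v)) (T.fluct p sel (grad w))

/-- The linear stabilization `s_h(w, v)`. -/
def stabForm (sel : Euc d → ι) (b : Euc d → Euc d) (w v : C(closure Ω, ℝ)) : ℝ :=
  ∑ e, T.stabConst p sel e * T.visc p b e * T.fluctForm p sel e v w

/-- The nonlinear stabilization `d_h(u; w, v)`. It depends on `u` through the values `γ_e(u)`
only. -/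
def nonlinForm (sel : Euc d → ι) (b : Euc d → Euc d) (γ : ι → T.space p → ℝ) (u : T.space p)
    (w v : C(closure Ω, ℝ)) : ℝ :=
  ∑ e, (1 - γ e u) * T.visc p b e *
      (innerL2 (T.patch e) (grad v) (grad w) - T.stabConst p sel e * T.fluctForm p sel e v w) +
    ∑ e, γ e u * T.visc p b e * (1 - T.stabConst p sel e) * T.fluctForm p sel e v w

end FEMesh

/-- `a(u, v) = ε (∇u, ∇v) + (b · ∇u, v) + (c u, v)`. -/
def cdrForm {d : ℕ} {Ω : Set (Euc d)} (ε : ℝ) (b : Euc d → Euc d) (c : Euc d → ℝ)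
    (u v : C(closure Ω, ℝ)) : ℝ :=
  ε * innerL2 Ω (grad u) (grad v) + (∫ x in Ω, inner ℝ (b x) (grad u x) * extZero v x) +
    ∫ x in Ω, c x * extZero u x * extZero v x

end

/-!
The problem is linear once the blending factors are frozen at some `t ∈ [0, 1]^ι`, and the frozen
linear problem on `V_{h,0}` is uniquely solvable, since its form is definite. Its solution `u(t)`
depends continuously on `t`, so that Brouwer's theorem gives a fixed point of `t ↦ γ(u(t))` in the
cube; the solution frozen at this fixed point solves the nonlinear problem
(`exists_solution_of_frozen_definite`).

Definiteness is `FEMesh.eq_zero_of_cdrForm_nonpos` for the form `a` and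
`FEMesh.frozenStab_self_nonneg` for the stabilization. For `w ∈ V_{h,0}`, the identity
`(b · ∇w, w) = -(1/2) (div b, w²)` (`integral_convection_of_isH10`) and the lower bound for
`c - (1/2) div b` give `a(w, w) ≥ ε ‖∇w‖² + σ₀ ‖w‖²`. The stabilization is a sum of nonnegative
terms, because `ω_e` is made for the bound `ω_e ‖κ_e ∇w‖² ≤ ‖∇w‖²` on the patch
(`FEMesh.stabConst_mul_fluctForm_le`). Both facts speak of weak gradients, whereas the forms are
defined by the classical gradient inside the elements. The two agree almost everywhere
(`FEMesh.grad_ae_eq_of_isH1`): inside an element a finite element function is a polynomial composed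
with a local inverse of the reference map, hence differentiable with bounded gradient, and the
boundaries of the elements are null sets. A Lipschitz domain is the interior of its closure
(`HasLipschitzBoundary.interior_closure`), so the elements and patches do not leave `Ω`.

Brouwer's theorem is derived from Scarf's combinatorial lemma
(`exists_isDominant_image_eq_univ`), which needs no triangulation. The grid points of the simplex
are ranked by each of their coordinates. A dominant set, one whose worst elements are not
simultaneously beaten by any grid point, has small diameter; a parity argument as for Sperner's
lemma shows that some dominant set carries every colour, and colouring `x` by an `i` with
`x i ≤ f x i` makes it an approximate fixed point.
-/

/-! ### Scarf's combinatorial lemma -/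

section Scarf

variable {V I α : Type*} [LinearOrder α]

/-- A finite set `R` of vertices is dominant for the family `r i` of rankings (a larger value being
better) if no vertex beats the last element of `R` in every ranking. -/
def IsDominant (r : I → V → α) (R : Finset V) : Prop :=
  ∀ y, ∃ i, ∀ x ∈ R, r i y ≤ r i x

theorem IsDominant.mono {r : I → V → α} {R S : Finset V} (hR : IsDominant r R) (h : S ⊆ R) :
    IsDominant r S := fun y => by
  obtain ⟨i, hi⟩ := hR y
  exact ⟨i, fun x hx => hi x (h hx)⟩

variable [Fintype I] [DecidableEq I] [DecidableEq V]

/-- The parity step of Sperner's lemma: a set of as many vertices as there are colours which misses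
a colour has an even number of facets coloured by all the colours but `i₀`. -/
theorem even_card_facets (c : V → I) (i₀ : I) {R : Finset V} (hR : R.card = Fintype.card I)
    (hc : R.image c ≠ Finset.univ) :
    Even ((R.filter fun x => (R.erase x).image c = Finset.univ.erase i₀).card) := by
  by_cases h : ∃ x ∈ R, (R.erase x).image c = Finset.univ.erase i₀
  swap
  · rw [Finset.filter_eq_empty_iff.2 fun x hx hx' => h ⟨x, hx, hx'⟩]
    simp
  obtain ⟨x, hx, hxc⟩ := h
  have hcx : c x ≠ i₀ := by
    rintro rfl
    apply hc
    rw [← Finset.insert_erase hx, Finset.image_insert, hxc]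
    exact Finset.insert_erase (Finset.mem_univ _)
  have : c x ∈ (R.erase x).image c := by
    rw [hxc]
    exact Finset.mem_erase.2 ⟨hcx, Finset.mem_univ _⟩
  obtain ⟨x', hx', hcx'⟩ := Finset.mem_image.1 this
  obtain ⟨hne, hx'R⟩ := Finset.mem_erase.1 hx'
  have hcard : ∀ z ∈ R, (R.erase z).image c = Finset.univ.erase i₀ →
      InjOn c (R.erase z : Finset V) := by
    intro z hz hzc
    apply Finset.card_image_iff.1
    rw [hzc, Finset.card_erase_of_mem hz, Finset.card_erase_of_mem (Finset.mem_univ _), hR,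
      Finset.card_univ]
  have key : (R.filter fun x => (R.erase x).image c = Finset.univ.erase i₀) = {x, x'} := by
    ext z
    simp only [Finset.mem_filter, Finset.mem_insert, Finset.mem_singleton]
    constructor
    · rintro ⟨hz, hzc⟩
      by_contra! hcon
      exact hne (hcard z hz hzc (Finset.mem_coe.2 (Finset.mem_erase.2 ⟨hcon.2.symm, hx'R⟩))
        (Finset.mem_coe.2 (Finset.mem_erase.2 ⟨hcon.1.symm, hx⟩)) hcx')
    · rintro (rfl | rfl)
      · exact ⟨hx, hxc⟩
      · refine ⟨hx'R, ?_⟩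
        rw [← hxc]
        ext i
        simp only [Finset.mem_image, Finset.mem_erase]
        constructor
        · rintro ⟨w, ⟨hw1, hw2⟩, rfl⟩
          by_cases hwx : w = x
          · exact ⟨z, ⟨hne, hx'R⟩, by rw [hwx, hcx']⟩
          · exact ⟨w, ⟨hwx, hw2⟩, rfl⟩
        · rintro ⟨w, ⟨hw1, hw2⟩, rfl⟩
          by_cases hwx : w = z
          · exact ⟨x, ⟨hne.symm, hx⟩, by rw [hwx, hcx']⟩
          · exact ⟨w, ⟨hwx, hw2⟩, rfl⟩
  rw [key, Finset.card_pair hne.symm]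
  exact even_two

/-- Let `D` be a dominant set with one element less than there are rankings, and `μ i` its last
element in the ranking `i`. There are two rankings `a ≠ b` with the same last element of `D`, and
the dominant sets obtained by adding one vertex `y` to `D` correspond to those `i ∈ {a, b}` for which
some vertex beats `μ j` for all `j ≠ i`: the only choice of `y` is the best of these vertices in the
ranking `i`. -/
theorem exists_pair_cofacets [Fintype V] {r : I → V → α} (hr : ∀ i, Function.Injective (r i))
    {D : Finset V} (hD : IsDominant r D) (hcard : D.card + 1 = Fintype.card I)
    (μ : I → V) (hμ : ∀ i, μ i ∈ D) (hμ' : ∀ i, ∀ z ∈ D, r i (μ i) ≤ r i z) :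
    ∃ a b, a ≠ b ∧ μ a = μ b ∧
      (∀ y, y ∉ D → IsDominant r (insert y D) →
        (∀ j, j ≠ a → r j (μ j) < r j y) ∨ (∀ j, j ≠ b → r j (μ j) < r j y)) ∧
      (∀ y, ¬ ((∀ j, j ≠ a → r j (μ j) < r j y) ∧ (∀ j, j ≠ b → r j (μ j) < r j y))) ∧
      (∀ i, (∃ y, ∀ j, j ≠ i → r j (μ j) < r j y) → (i = a ∨ i = b) →
        ∃ y, y ∉ D ∧ IsDominant r (insert y D) ∧ ∀ j, j ≠ i → r j (μ j) < r j y) ∧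
      (∀ i y y', IsDominant r (insert y D) → IsDominant r (insert y' D) →
        (∀ j, j ≠ i → r j (μ j) < r j y) → (∀ j, j ≠ i → r j (μ j) < r j y') → y = y') := by
  have cover : ∀ E : Finset I, (∀ x ∈ D, ∃ i ∈ E, μ i = x) → D.card ≤ E.card := by
    intro E hE
    apply Finset.card_le_card_of_surjOn μ
    intro x hx
    obtain ⟨i, hi, rfl⟩ := hE x hx
    exact ⟨i, hi, rfl⟩
  have eqμ : ∀ i x, x ∈ D → (∀ z ∈ D, r i x ≤ r i z) → μ i = x := fun i x hx h =>
    hr i (le_antisymm (hμ' i x hx) (h _ (hμ i)))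
  obtain ⟨a, -, b, -, hab, hμab⟩ :=
    Finset.exists_ne_map_eq_of_card_lt_of_maps_to (s := (Finset.univ : Finset I)) (t := D)
      (by rw [Finset.card_univ]; omega) (f := μ) (fun i _ => hμ i)
  -- a ranking that is not needed to cover `D` by last elements is `a` or `b`
  have hpair : ∀ i, (∀ x ∈ D, ∃ k, k ≠ i ∧ μ k = x) → i = a ∨ i = b := by
    intro i hi
    by_contra! hcon
    have := cover ((Finset.univ.erase i).erase a) (by
      intro x hx
      obtain ⟨k, hk, rfl⟩ := hi x hx
      by_cases hka : k = a
      · exact ⟨b, by simp [hab.symm, hcon.2.symm], by rw [hka, hμab]⟩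
      · exact ⟨k, by simp [hk, hka], rfl⟩)
    rw [Finset.card_erase_of_mem (by simp [hcon.1.symm]), Finset.card_erase_of_mem (by simp),
      Finset.card_univ] at this
    have : 0 < D.card := Finset.card_pos.2 ⟨_, hμ a⟩
    omega
  -- as `D` is dominant, a vertex that beats `μ j` for all `j ≠ i` does not beat `μ i`
  have hself : ∀ i y, (∀ j, j ≠ i → r j (μ j) < r j y) → ∀ z ∈ D, r i y ≤ r i z := by
    intro i y hy
    obtain ⟨j, hj⟩ := hD y
    by_cases hji : j = i
    · rwa [hji] at hj
    · exact absurd (hj _ (hμ j)) (not_le.2 (hy j hji))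
  refine ⟨a, b, hab, hμab, ?_, ?_, ?_, ?_⟩
  · intro y hy hdom
    obtain ⟨i, hi⟩ := hdom y
    have hiM : ∀ j, j ≠ i → r j (μ j) < r j y := by
      intro j hji
      by_contra! hcon
      have := cover ((Finset.univ.erase i).erase j) (by
        intro x hx
        obtain ⟨k, hk⟩ := hdom x
        have hxy : x ≠ y := fun h => hy (h ▸ hx)
        refine ⟨k, ?_, eqμ k x hx fun z hz => hk z (Finset.mem_insert_of_mem hz)⟩
        have hk' := hk y (Finset.mem_insert_self _ _)
        simp only [Finset.mem_erase, Finset.mem_univ, and_true]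
        constructor
        · rintro rfl
          exact hxy (hr k (le_antisymm hk' (hcon.trans (hμ' _ _ hx))))
        · rintro rfl
          exact hxy (hr k (le_antisymm hk' (hi _ (Finset.mem_insert_of_mem hx)))))
      rw [Finset.card_erase_of_mem (by simp [hji]), Finset.card_erase_of_mem (by simp),
        Finset.card_univ] at this
      have : 0 < D.card := Finset.card_pos.2 ⟨_, hμ a⟩
      omega
    have := hpair i (by
      intro x hx
      obtain ⟨k, hk⟩ := hdom x
      refine ⟨k, ?_, eqμ k x hx fun z hz => hk z (Finset.mem_insert_of_mem hz)⟩
      rintro rfl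
      have hxy : x ≠ y := fun h => hy (h ▸ hx)
      exact hxy (hr k (le_antisymm (hk y (Finset.mem_insert_self _ _))
        (hi _ (Finset.mem_insert_of_mem hx)))))
    rcases this with rfl | rfl
    · exact Or.inl hiM
    · exact Or.inr hiM
  · rintro y ⟨hya, hyb⟩
    exact absurd (hself a y hya _ (hμ a)) (not_le.2 (hyb a hab))
  · intro i hne hi
    obtain ⟨i', hi', hμi⟩ : ∃ i', i' ≠ i ∧ μ i = μ i' := by
      rcases hi with rfl | rfl
      · exact ⟨b, hab.symm, hμab⟩
      · exact ⟨a, hab, hμab.symm⟩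
    classical
    obtain ⟨y, hyM, hymax⟩ := Finset.exists_max_image
      (Finset.univ.filter fun y => ∀ j, j ≠ i → r j (μ j) < r j y) (r i)
      (by obtain ⟨y, hy⟩ := hne; exact ⟨y, by simpa using hy⟩)
    have hyM : ∀ j, j ≠ i → r j (μ j) < r j y := by simpa using hyM
    refine ⟨y, ?_, ?_, hyM⟩
    · intro hyD
      have h1 : μ i = y := eqμ i y hyD (hself i y hyM)
      have h2 := hyM i' hi'
      rw [← hμi, h1] at h2
      exact lt_irrefl _ h2
    · intro z
      by_cases hz : ∀ j, j ≠ i → r j (μ j) < r j z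
      · refine ⟨i, fun x hx => ?_⟩
        have hzy := hymax z (by simpa using hz)
        rcases Finset.mem_insert.1 hx with rfl | hx
        · exact hzy
        · exact hzy.trans (hself i y hyM x hx)
      · push Not at hz
        obtain ⟨j, hji, hj⟩ := hz
        refine ⟨j, fun x hx => ?_⟩
        rcases Finset.mem_insert.1 hx with rfl | hx
        · exact hj.trans (hyM j hji).le
        · exact hj.trans (hμ' j x hx)
  · have key : ∀ i y y', IsDominant r (insert y D) → (∀ j, j ≠ i → r j (μ j) < r j y') →
        r i y' ≤ r i y := by
      intro i y y' hdom hy'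
      obtain ⟨j, hj⟩ := hdom y'
      by_cases hji : j = i
      · rw [← hji]
        exact hj y (Finset.mem_insert_self _ _)
      · exact absurd (hj _ (Finset.mem_insert_of_mem (hμ j))) (not_le.2 (hy' j hji))
    intro i y y' h h' hy hy'
    exact hr i (le_antisymm (key i y' y h' hy) (key i y y' h hy'))

/-- **Scarf's lemma.** Let `s i` be special vertices, where `s i` is last in the ranking `i` and
beats the ordinary (non-special) vertices in all the other rankings. If `s i` has the colour `i`,
then some dominant set has exactly one vertex of every colour. The proof counts the pairs of a room
(a dominant set with as many elements as there are colours) and a door contained in it (a dominant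
set with one element of each colour but `i₀`). If no room had all the colours, every room would have
an even number of doors, whereas exactly one door belongs to an odd number of rooms. -/
theorem exists_isDominant_image_eq_univ [Fintype V] [Nonempty I] {r : I → V → α}
    (hr : ∀ i, Function.Injective (r i)) (s : I → V) (hs : ∀ i v, r i (s i) ≤ r i v)
    (hs' : ∀ i j v, j ≠ i → v ∉ range s → r j v < r j (s i)) (hT : ∃ v, v ∉ range s)
    (c : V → I) (hc : ∀ i, c (s i) = i) :
    ∃ R : Finset V, IsDominant r R ∧ R.card = Fintype.card I ∧ R.image c = Finset.univ := by
  classical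
  by_contra! hcon
  obtain ⟨i₀⟩ := ‹Nonempty I›
  have hI : 0 < Fintype.card I := Fintype.card_pos_iff.2 ⟨i₀⟩
  let rooms : Finset (Finset V) :=
    Finset.univ.filter fun R => IsDominant r R ∧ R.card = Fintype.card I
  let doors : Finset (Finset V) := Finset.univ.filter fun D => IsDominant r D ∧
    D.image c = Finset.univ.erase i₀ ∧ D.card + 1 = Fintype.card I
  let D₀ : Finset V := (Finset.univ.erase i₀).image s
  have hsinj : Function.Injective s := fun i j h => by rw [← hc i, h, hc j]
  have hcount := Finset.sum_card_bipartiteAbove_eq_sum_card_bipartiteBelow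
    (s := rooms) (t := doors) (fun R D => D ⊆ R)
  -- every room has an even number of doors
  have hrooms : ∀ R ∈ rooms, Even (doors.bipartiteAbove (fun R D => D ⊆ R) R).card := by
    intro R hR
    obtain ⟨hdom, hcard⟩ : IsDominant r R ∧ R.card = Fintype.card I := by
      simpa [rooms] using hR
    have h := even_card_facets c i₀ hcard (hcon R hdom hcard)
    have : doors.bipartiteAbove (fun R D => D ⊆ R) R =
        (R.filter fun x => (R.erase x).image c = Finset.univ.erase i₀).image R.erase := by
      ext D
      simp only [Finset.mem_bipartiteAbove, doors, Finset.mem_filter, Finset.mem_univ, true_and,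
        Finset.mem_image]
      constructor
      · rintro ⟨⟨h1, h2, h3⟩, h4⟩
        obtain ⟨x, hx, rfl⟩ := Finset.exists_eq_insert_iff.2 ⟨h4, h3.trans hcard.symm⟩
        have : (insert x D).erase x = D := Finset.erase_insert hx
        exact ⟨x, ⟨Finset.mem_insert_self _ _, by rw [this, h2]⟩, this⟩
      · rintro ⟨x, ⟨hx, hxc⟩, rfl⟩
        refine ⟨⟨hdom.mono (Finset.erase_subset _ _), hxc, ?_⟩, Finset.erase_subset _ _⟩
        rw [Finset.card_erase_add_one hx, hcard]
    rw [this, Finset.card_image_of_injOn]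
    · exact h
    · intro x hx y hy hxy
      by_contra hne
      have hx' : x ∈ R := (Finset.mem_filter.1 hx).1
      have : x ∈ R.erase y := Finset.mem_erase.2 ⟨hne, hx'⟩
      rw [← show R.erase x = R.erase y from hxy] at this
      exact Finset.notMem_erase _ _ this
  have hbelow : ∀ D ∈ doors, (rooms.bipartiteBelow (fun R D => D ⊆ R) D).card =
      (Finset.univ.filter fun y => y ∉ D ∧ IsDominant r (insert y D)).card := by
    intro D hD
    obtain ⟨hdom, himg, hcard⟩ : IsDominant r D ∧ D.image c = Finset.univ.erase i₀ ∧
        D.card + 1 = Fintype.card I := by simpa [doors] using hD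
    have : rooms.bipartiteBelow (fun R D => D ⊆ R) D =
        (Finset.univ.filter fun y => y ∉ D ∧ IsDominant r (insert y D)).image
          fun y => insert y D := by
      ext R
      simp only [Finset.mem_bipartiteBelow, rooms, Finset.mem_filter, Finset.mem_univ, true_and,
        Finset.mem_image]
      constructor
      · rintro ⟨⟨h1, h2⟩, h3⟩
        obtain ⟨y, hy, rfl⟩ := Finset.exists_eq_insert_iff.2 ⟨h3, hcard.trans h2.symm⟩
        exact ⟨y, ⟨hy, h1⟩, rfl⟩
      · rintro ⟨y, ⟨hy, h1⟩, rfl⟩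
        exact ⟨⟨h1, by rw [Finset.card_insert_of_notMem hy, hcard]⟩, Finset.subset_insert _ _⟩
    rw [this, Finset.card_image_of_injOn]
    intro y hy z hz hyz
    have hy' : y ∉ D := (Finset.mem_filter.1 hy).2.1
    have : y ∈ insert z D := by
      rw [← show insert y D = insert z D from hyz]
      exact Finset.mem_insert_self _ _
    exact (Finset.mem_insert.1 this).resolve_right hy'
  -- the door `D₀` made of special vertices belongs to one room
  obtain ⟨y₀, hy₀T, hy₀max⟩ := Finset.exists_max_image
    (Finset.univ.filter fun y => y ∉ range s) (r i₀)
    (by obtain ⟨v, hv⟩ := hT; exact ⟨v, by simpa using hv⟩)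
  have hy₀T : y₀ ∉ range s := by simpa using hy₀T
  have hD₀sub : ∀ x ∈ D₀, x ∈ range s := fun x hx => by
    obtain ⟨i, -, rfl⟩ := Finset.mem_image.1 hx
    exact mem_range_self i
  have hD₀ : ∀ y, (y ∉ D₀ ∧ IsDominant r (insert y D₀)) ↔ y = y₀ := by
    intro y
    constructor
    · rintro ⟨hy, hdom⟩
      have hyT : y ∉ range s := by
        rintro ⟨i, rfl⟩
        obtain rfl : i = i₀ := by
          by_contra hi
          exact hy (Finset.mem_image_of_mem _ (Finset.mem_erase.2 ⟨hi, Finset.mem_univ _⟩))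
        obtain ⟨j, hj⟩ := hdom y₀
        have hsj : s j ∈ insert (s i) D₀ := by
          by_cases hji : j = i
          · rw [hji]; exact Finset.mem_insert_self _ _
          · exact Finset.mem_insert_of_mem
              (Finset.mem_image_of_mem _ (Finset.mem_erase.2 ⟨hji, Finset.mem_univ _⟩))
        exact hy₀T ⟨j, hr j (le_antisymm (hs j y₀) (hj _ hsj))⟩
      apply hr i₀
      refine le_antisymm (hy₀max y (by simpa using hyT)) ?_
      obtain ⟨j, hj⟩ := hdom y₀
      by_cases hji : j = i₀
      · rw [hji] at hj
        exact hj _ (Finset.mem_insert_self _ _)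
      · have := hj (s j) (Finset.mem_insert_of_mem
          (Finset.mem_image_of_mem _ (Finset.mem_erase.2 ⟨hji, Finset.mem_univ _⟩)))
        exact absurd ⟨j, hr j (le_antisymm (hs j y₀) this)⟩ hy₀T
    · rintro rfl
      refine ⟨fun h => hy₀T (hD₀sub _ h), fun z => ?_⟩
      by_cases hz : z ∈ range s
      · obtain ⟨i, rfl⟩ := hz
        exact ⟨i, fun x _ => hs i x⟩
      · refine ⟨i₀, fun x hx => ?_⟩
        rcases Finset.mem_insert.1 hx with rfl | hx
        · exact hy₀max z (by simpa using hz)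
        · obtain ⟨i, hi, rfl⟩ := Finset.mem_image.1 hx
          exact (hs' i i₀ z (Finset.ne_of_mem_erase hi).symm hz).le
  have hD₀mem : D₀ ∈ doors := by
    have h1 := ((hD₀ y₀).2 rfl).2.mono (Finset.subset_insert _ _)
    have h2 : D₀.image c = Finset.univ.erase i₀ := by
      simp only [D₀, Finset.image_image]
      rw [show c ∘ s = id from funext hc, Finset.image_id]
    have h3 : D₀.card + 1 = Fintype.card I := by
      rw [Finset.card_image_of_injective _ hsinj, Finset.card_erase_of_mem (Finset.mem_univ _),
        Finset.card_univ]
      omega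
    simp [doors, h1, h2, h3]
  -- every other door belongs to two rooms
  have hdoors : ∀ D ∈ doors.erase D₀, (rooms.bipartiteBelow (fun R D => D ⊆ R) D).card = 2 := by
    intro D hD
    obtain ⟨hne, hD⟩ := Finset.mem_erase.1 hD
    rw [hbelow D hD]
    obtain ⟨hdom, himg, hcard⟩ : IsDominant r D ∧ D.image c = Finset.univ.erase i₀ ∧
        D.card + 1 = Fintype.card I := by simpa [doors] using hD
    obtain ⟨t, htD, ht⟩ : ∃ t ∈ D, t ∉ range s := by
      by_contra! hall
      apply hne
      simp only [D₀]
      rw [← himg, Finset.image_image]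
      ext x
      constructor
      · intro hx
        obtain ⟨i, rfl⟩ := hall x hx
        exact Finset.mem_image.2 ⟨s i, hx, by simp [hc]⟩
      · intro hx
        obtain ⟨x', hx', rfl⟩ := Finset.mem_image.1 hx
        obtain ⟨i, rfl⟩ := hall x' hx'
        simpa [hc] using hx'
    have hmin : ∀ i, ∃ x ∈ D, ∀ z ∈ D, r i x ≤ r i z := fun i =>
      Finset.exists_min_image D (r i) ⟨t, htD⟩
    choose μ hμ hμ' using hmin
    obtain ⟨a, b, hab, -, hor, hnot, hex, huniq⟩ :=
      exists_pair_cofacets hr hdom hcard μ hμ hμ'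
    have hM : ∀ i, ∃ y, ∀ j, j ≠ i → r j (μ j) < r j y := fun i =>
      ⟨s i, fun j hji => (hμ' j t htD).trans_lt (hs' i j t hji ht)⟩
    obtain ⟨ya, hya, hyad, hyaM⟩ := hex a (hM a) (Or.inl rfl)
    obtain ⟨yb, hyb, hybd, hybM⟩ := hex b (hM b) (Or.inr rfl)
    have : (Finset.univ.filter fun y => y ∉ D ∧ IsDominant r (insert y D)) = {ya, yb} := by
      ext y
      simp only [Finset.mem_filter, Finset.mem_univ, true_and, Finset.mem_insert,
        Finset.mem_singleton]
      constructor
      · rintro ⟨hy, hyd⟩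
        rcases hor y hy hyd with h | h
        · exact Or.inl (huniq a y ya hyd hyad h hyaM)
        · exact Or.inr (huniq b y yb hyd hybd h hybM)
      · rintro (rfl | rfl)
        · exact ⟨hya, hyad⟩
        · exact ⟨hyb, hybd⟩
    rw [this, Finset.card_pair]
    rintro rfl
    exact hnot ya ⟨hyaM, hybM⟩
  rw [← Finset.add_sum_erase _ _ hD₀mem, hbelow D₀ hD₀mem, Finset.sum_congr rfl hdoors] at hcount
  have h1 : (Finset.univ.filter fun y => y ∉ D₀ ∧ IsDominant r (insert y D₀)) = {y₀} := by
    ext y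
    simp [hD₀ y]
  rw [h1, Finset.card_singleton, Finset.sum_const] at hcount
  have h2 := Finset.even_sum _ hrooms
  rw [hcount] at h2
  have h3 : Even ((doors.erase D₀).card • 2) := by simp
  rw [Nat.even_add] at h2
  exact absurd (h2.2 h3) (by decide)

end Scarf

/-! ### Brouwer's fixed point theorem -/

section Brouwer

variable {I : Type*} [Fintype I]

/-- The points of the standard simplex with coordinates in `ℕ / k`, multiplied by `k`. -/
abbrev SimplexGrid (I : Type*) [Fintype I] (k : ℕ) := {x : I → Fin (k + 1) // ∑ i, (x i : ℕ) = k}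

/-- The point of the standard simplex that corresponds to a grid point. -/
noncomputable def SimplexGrid.toReal {k : ℕ} (x : SimplexGrid I k) (i : I) : ℝ :=
  (x.1 i : ℕ) / (k : ℝ)

theorem SimplexGrid.toReal_mem {k : ℕ} (hk : 0 < k) (x : SimplexGrid I k) :
    x.toReal ∈ stdSimplex ℝ I := by
  refine ⟨fun i => by unfold SimplexGrid.toReal; positivity, ?_⟩
  simp only [SimplexGrid.toReal]
  rw [← Finset.sum_div, ← Nat.cast_sum, x.2]
  field_simp

theorem SimplexGrid.exists_of_sum_le [Nonempty I] {k : ℕ} (l : I → ℕ) (hl : ∑ i, l i ≤ k) :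
    ∃ x : SimplexGrid I k, ∀ i, l i ≤ (x.1 i : ℕ) := by
  classical
  obtain ⟨i₀⟩ := ‹Nonempty I›
  let y : I → ℕ := l + Pi.single i₀ (k - ∑ i, l i)
  have hy : ∑ i, y i = k := by
    simp only [y, Pi.add_apply, Finset.sum_add_distrib, Finset.sum_pi_single', Finset.mem_univ,
      if_true]
    omega
  have hyk : ∀ i, y i < k + 1 := fun i =>
    Nat.lt_succ_of_le (hy ▸ Finset.single_le_sum (fun j _ => Nat.zero_le (y j)) (Finset.mem_univ i))
  exact ⟨⟨fun i => ⟨y i, hyk i⟩, hy⟩, fun i => Nat.le_add_right _ _⟩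

/-- Scarf's lemma applied to the grid points, ranked by their coordinates, where `x` may be coloured
by `i` if `x i ≤ f x i`. All the points of the dominant set it gives are close to `z`, and those
coordinates for which it contains no point of the colour `i` are close to zero. -/
theorem exists_approx_fixedPoint [Nonempty I] (f : (I → ℝ) → I → ℝ)
    (hf : MapsTo f (stdSimplex ℝ I) (stdSimplex ℝ I)) {k : ℕ} (hk : 0 < k) :
    ∃ z ∈ stdSimplex ℝ I, ∀ i, ∃ x ∈ stdSimplex ℝ I,
      (∀ j, |x j - z j| ≤ Fintype.card I / k) ∧ x i ≤ f x i + Fintype.card I / k := by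
  classical
  have hcol : ∀ x : SimplexGrid I k, ∃ i, x.toReal i ≤ f x.toReal i := by
    intro x
    by_contra! hcon
    have h1 := (hf (x.toReal_mem hk)).2
    have h2 := (x.toReal_mem hk).2
    have := Finset.sum_lt_sum_of_nonempty Finset.univ_nonempty fun i _ => hcon i
    linarith
  choose col hcol using hcol
  let V := SimplexGrid I k ⊕ I
  let ρ : I → V → ℕ := fun i =>
    Sum.elim (fun x => (x.1 i : ℕ) + 1) fun j => if j = i then 0 else k + 2
  -- ties are broken by an enumeration of the vertices
  let r : I → V → ℕ ×ₗ ℕ := fun i v => toLex (ρ i v, (Fintype.equivFin V v : ℕ))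
  have hρ : ∀ {i v w}, r i v ≤ r i w → ρ i v ≤ ρ i w := fun h => Prod.Lex.monotone_fst _ _ h
  have hρ' : ∀ {i v w}, ρ i v < ρ i w → r i v < r i w := fun h =>
    Prod.Lex.toLex_lt_toLex.2 (Or.inl h)
  have hr : ∀ i, Function.Injective (r i) := by
    intro i v w h
    have := congrArg (fun p => (ofLex p).2) h
    exact (Fintype.equivFin V).injective (Fin.ext this)
  have hinl : ∀ v : V, v ∉ range (Sum.inr : I → V) → ∃ x, v = Sum.inl x := by
    rintro (x | j) h
    · exact ⟨x, rfl⟩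
    · exact absurd (mem_range_self j) h
  obtain ⟨t, -⟩ := SimplexGrid.exists_of_sum_le (I := I) (k := k) 0 (by simp)
  obtain ⟨R, hdom, -, himg⟩ := exists_isDominant_image_eq_univ hr (Sum.inr : I → V)
    (by
      intro i v
      by_cases h : v = Sum.inr i
      · rw [h]
      · refine (hρ' ?_).le
        rcases v with x | j
        · simp [ρ]
        · have : j ≠ i := fun h' => h (by rw [h'])
          simp [ρ, this])
    (by
      intro i j v hji hv
      obtain ⟨x, rfl⟩ := hinl v hv
      apply hρ'
      have := (x.1 j).2
      simp only [ρ, Sum.elim_inl, Sum.elim_inr, if_neg hji.symm]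
      omega)
    ⟨Sum.inl t, by simp⟩ (Sum.elim col id) (fun i => rfl)
  let S : Finset (SimplexGrid I k) := Finset.univ.filter fun x => Sum.inl x ∈ R
  have hS : ∀ x, x ∈ S ↔ Sum.inl x ∈ R := by simp [S]
  -- a grid point beats the special vertex of `i` in the ranking `i`, so if `R` contains this vertex,
  -- it is in another ranking that the grid point fails to beat the last element of `R`
  have hdom' : ∀ y : SimplexGrid I k, ∃ i, Sum.inr i ∉ R ∧ ∀ x ∈ S, (y.1 i : ℕ) ≤ x.1 i := by
    intro y
    obtain ⟨i, hi⟩ := hdom (Sum.inl y)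
    refine ⟨i, fun h => ?_, fun x hx => ?_⟩
    · have := hρ (hi _ h)
      simp [ρ] at this
    · have := hρ (hi _ ((hS x).1 hx))
      simpa [ρ] using this
  have hcolS : ∀ i, Sum.inr i ∉ R → ∃ x ∈ S, col x = i := by
    intro i hi
    obtain ⟨v, hv, hvi⟩ := Finset.mem_image.1 (himg ▸ Finset.mem_univ i)
    rcases v with x | j
    · exact ⟨x, (hS x).2 hv, hvi⟩
    · obtain rfl : j = i := hvi
      exact absurd hv hi
  obtain ⟨z, hz⟩ : S.Nonempty := by
    obtain ⟨i, hi, -⟩ := hdom' t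
    obtain ⟨x, hx, -⟩ := hcolS i hi
    exact ⟨x, hx⟩
  have hmin : ∀ i, ∃ x ∈ S, ∀ y ∈ S, (x.1 i : ℕ) ≤ y.1 i := fun i =>
    Finset.exists_min_image S (fun x => (x.1 i : ℕ)) ⟨z, hz⟩
  choose m hmS hm using hmin
  let l : I → ℕ := fun i => if Sum.inr i ∈ R then 0 else (m i).1 i
  have hl : ∀ x ∈ S, ∀ i, l i ≤ x.1 i := by
    intro x hx i
    simp only [l]
    split_ifs
    · exact Nat.zero_le _
    · exact hm i x hx
  -- otherwise some grid point would beat the last point of `S` in every ranking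
  have hsum : k < ∑ i, (l i + 1) := by
    by_contra! hcon
    obtain ⟨y, hy⟩ := SimplexGrid.exists_of_sum_le _ hcon
    obtain ⟨i, hi, hi'⟩ := hdom' y
    have h1 := hi' _ (hmS i)
    have h2 := hy i
    simp only [l, if_neg hi] at h2
    omega
  have hupper : ∀ x ∈ S, ∀ i, (x.1 i : ℕ) ≤ l i + Fintype.card I := by
    intro x hx i
    have h1 := x.2
    have h2 : ∑ j ∈ Finset.univ.erase i, l j ≤ ∑ j ∈ Finset.univ.erase i, (x.1 j : ℕ) :=
      Finset.sum_le_sum fun j _ => hl x hx j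
    rw [← Finset.add_sum_erase _ _ (Finset.mem_univ i)] at h1
    rw [Finset.sum_add_distrib, ← Finset.add_sum_erase _ _ (Finset.mem_univ i)] at hsum
    simp only [Finset.sum_const, Finset.card_univ, smul_eq_mul, mul_one] at hsum
    omega
  have hkR : (0 : ℝ) < k := Nat.cast_pos.2 hk
  refine ⟨z.toReal, z.toReal_mem hk, fun i => ?_⟩
  by_cases hi : Sum.inr i ∈ R
  · refine ⟨z.toReal, z.toReal_mem hk, fun j => by simp; positivity, ?_⟩
    have h1 := hupper z hz i
    simp only [l, if_pos hi, zero_add] at h1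
    have h2 : z.toReal i ≤ Fintype.card I / k := by
      unfold SimplexGrid.toReal
      gcongr
    have h3 := (hf (z.toReal_mem hk)).1 i
    linarith
  · obtain ⟨x, hx, hxi⟩ := hcolS i hi
    refine ⟨x.toReal, x.toReal_mem hk, fun j => ?_, ?_⟩
    · unfold SimplexGrid.toReal
      rw [← sub_div, abs_div, abs_of_pos hkR]
      gcongr
      have h1 := hl x hx j
      have h2 := hl z hz j
      have h3 := hupper x hx j
      have h4 := hupper z hz j
      rw [abs_le]
      constructor
      · have : (((z.1 j : ℕ) : ℕ) : ℝ) ≤ (x.1 j : ℕ) + Fintype.card I := by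
          exact_mod_cast (by omega : (z.1 j : ℕ) ≤ x.1 j + Fintype.card I)
        linarith
      · have : (((x.1 j : ℕ) : ℕ) : ℝ) ≤ (z.1 j : ℕ) + Fintype.card I := by
          exact_mod_cast (by omega : (x.1 j : ℕ) ≤ z.1 j + Fintype.card I)
        linarith
    · have h1 := hcol x
      rw [hxi] at h1
      have : (0 : ℝ) ≤ Fintype.card I / k := by positivity
      linarith

/-- **Brouwer's fixed point theorem** for the standard simplex. -/
theorem exists_fixedPoint_stdSimplex [Nonempty I] (f : (I → ℝ) → I → ℝ)
    (hf : MapsTo f (stdSimplex ℝ I) (stdSimplex ℝ I)) (hc : ContinuousOn f (stdSimplex ℝ I)) :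
    ∃ z ∈ stdSimplex ℝ I, f z = z := by
  have hcomp : IsCompact (stdSimplex ℝ I) := isCompact_stdSimplex ℝ I
  have hne : (stdSimplex ℝ I).Nonempty := by
    classical
    obtain ⟨i⟩ := ‹Nonempty I›
    exact ⟨_, single_mem_stdSimplex ℝ i⟩
  have happrox : ∀ ε > 0, ∃ z ∈ stdSimplex ℝ I, ∀ i, z i - f z i ≤ ε := by
    intro ε hε
    have huc := hcomp.uniformContinuousOn_of_continuous hc
    obtain ⟨δ, hδ, h⟩ := Metric.uniformContinuousOn_iff.1 huc (ε / 3) (by positivity)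
    obtain ⟨k, hk⟩ := exists_nat_gt (Fintype.card I / min δ (ε / 3))
    have hmin : 0 < min δ (ε / 3) := lt_min hδ (by positivity)
    have hk0 : 0 < k := by
      have : (0 : ℝ) < k := lt_of_le_of_lt (by positivity) hk
      exact_mod_cast this
    have hkR : (0 : ℝ) < k := Nat.cast_pos.2 hk0
    have hsmall : (Fintype.card I : ℝ) / k < min δ (ε / 3) := by
      rw [div_lt_iff₀ hmin] at hk
      rw [div_lt_iff₀ hkR]
      linarith
    obtain ⟨hsδ, hsε⟩ := lt_min_iff.1 hsmall
    obtain ⟨z, hz, hx⟩ := exists_approx_fixedPoint f hf hk0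
    refine ⟨z, hz, fun i => ?_⟩
    obtain ⟨x, hxs, hxz, hxi⟩ := hx i
    have hd : dist x z < δ := by
      rw [dist_pi_lt_iff hδ]
      exact fun j => (hxz j).trans_lt hsδ
    have h1 := (dist_le_pi_dist (f x) (f z) i).trans_lt (h x hxs z hz hd)
    have h2 := hxz i
    rw [Real.dist_eq] at h1
    have h3 := abs_lt.1 h1
    have h4 := abs_le.1 h2
    linarith [h3.2, h4.1]
  -- the total violation of `z i ≤ f z i`; without violation, equality holds since the sums agree
  let g : (I → ℝ) → ℝ := fun z => ∑ i, max 0 (z i - f z i)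
  have hg : ContinuousOn g (stdSimplex ℝ I) := by
    apply continuousOn_finsetSum
    intro i _
    exact continuousOn_const.sup ((continuous_apply i).continuousOn.sub
      ((continuous_apply i).comp_continuousOn hc))
  obtain ⟨z, hz, hzmin⟩ := hcomp.exists_isMinOn hne hg
  have hcard : (0 : ℝ) < Fintype.card I := Nat.cast_pos.2 Fintype.card_pos
  have hg0 : g z ≤ 0 := by
    apply le_of_forall_pos_le_add
    intro ε hε
    obtain ⟨w, hw, hwi⟩ := happrox (ε / Fintype.card I) (by positivity)
    have h1 : g z ≤ g w := hzmin hw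
    have h2 : g w ≤ ∑ i : I, ε / Fintype.card I :=
      Finset.sum_le_sum fun i _ => max_le (by positivity) (hwi i)
    simp only [Finset.sum_const, Finset.card_univ, nsmul_eq_mul] at h2
    rw [mul_div_cancel₀ _ hcard.ne'] at h2
    linarith
  have hle : ∀ i, z i ≤ f z i := by
    intro i
    have h1 : max 0 (z i - f z i) ≤ g z :=
      Finset.single_le_sum (f := fun i => max 0 (z i - f z i)) (fun j _ => le_max_left _ _)
        (Finset.mem_univ i)
    linarith [le_max_right 0 (z i - f z i)]
  refine ⟨z, hz, ?_⟩
  have hsum : ∑ i, z i = ∑ i, f z i := by rw [hz.2, (hf hz).2]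
  funext i
  exact ((Finset.sum_eq_sum_iff_of_le fun i _ => hle i).1 hsum i (Finset.mem_univ i)).symm

/-- **Brouwer's fixed point theorem** for the unit cube, which is a retract of a simplex. -/
theorem exists_fixedPoint_cube {ι : Type*} [Fintype ι] (f : (ι → ℝ) → ι → ℝ)
    (hf : MapsTo f (Icc 0 1) (Icc 0 1)) (hc : ContinuousOn f (Icc 0 1)) :
    ∃ t ∈ Icc (0 : ι → ℝ) 1, f t = t := by
  let N : ℝ := Fintype.card ι + 1
  have hN : 0 < N := by positivity
  let ρ : (Option ι → ℝ) → ι → ℝ := fun x i => min 1 (N * x (some i))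
  let s : (ι → ℝ) → Option ι → ℝ := fun t o => o.elim (1 - ∑ i, t i / N) fun i => t i / N
  have hρ : MapsTo ρ (stdSimplex ℝ (Option ι)) (Icc 0 1) := fun x hx =>
    ⟨fun i => le_min zero_le_one (mul_nonneg hN.le (hx.1 _)), fun i => min_le_left _ _⟩
  have hs : MapsTo s (Icc 0 1) (stdSimplex ℝ (Option ι)) := by
    intro t ht
    refine ⟨?_, by simp [s, Fintype.sum_option]⟩
    rintro (_ | i)
    · have : ∑ i, t i / N ≤ ∑ i : ι, 1 / N :=
        Finset.sum_le_sum fun i _ => by gcongr; exact ht.2 i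
      have h2 : ∑ i : ι, 1 / N ≤ 1 := by
        rw [Finset.sum_const, Finset.card_univ, nsmul_eq_mul, mul_one_div, div_le_one hN]
        simp [N]
      simp only [s, Option.elim]
      linarith
    · exact div_nonneg (ht.1 i) hN.le
  have hρs : ∀ t ∈ Icc (0 : ι → ℝ) 1, ρ (s t) = t := by
    intro t ht
    funext i
    have : N * (t i / N) = t i := by field_simp
    simp only [ρ, s, Option.elim, this]
    exact min_eq_right (ht.2 i)
  have hρc : Continuous ρ := by fun_prop
  have hsc : Continuous s := by
    refine continuous_pi ?_
    rintro (_ | i)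
    · change Continuous fun t : ι → ℝ => 1 - ∑ i, t i / N
      fun_prop
    · change Continuous fun t : ι → ℝ => t i / N
      fun_prop
  obtain ⟨z, hz, hfz⟩ := exists_fixedPoint_stdSimplex (fun x => s (f (ρ x)))
    (fun x hx => hs (hf (hρ hx)))
    (hsc.comp_continuousOn (hc.comp hρc.continuousOn hρ))
  refine ⟨ρ z, hρ hz, ?_⟩
  conv_rhs => rw [← hfz]
  exact (hρs _ (hf (hρ hz))).symm

end Brouwer

/-! ### Linear problems whose coefficients depend on the solution -/

/-- A quasilinear problem on a finite-dimensional space: if freezing the coefficients at any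
`t ∈ [0, 1]^ι` gives a definite form, and the coefficients depend continuously on the solution,
there is a solution. It comes from a fixed point of the map which sends `t` to the
coefficients at the solution of the linear problem frozen at `t`. -/
theorem exists_solution_of_frozen_definite {X ι : Type*} [AddCommGroup X] [Module ℝ X]
    [TopologicalSpace X] [IsTopologicalAddGroup X] [ContinuousSMul ℝ X] [Fintype ι]
    (W : Submodule ℝ X) [FiniteDimensional ℝ W] (B : (ι → ℝ) → X →ₗ[ℝ] X →ₗ[ℝ] ℝ)
    (hB : ∀ u v, Continuous fun t => B t u v) (l : X →ₗ[ℝ] ℝ) (γ : ι → X → ℝ)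
    (hγ : ∀ e u, γ e u ∈ Icc (0 : ℝ) 1) (hγc : ∀ e, Continuous (γ e))
    (hdef : ∀ t ∈ Icc (0 : ι → ℝ) 1, ∀ w ∈ W, B t w w = 0 → w = 0) (uD : X) :
    ∃ u, u - uD ∈ W ∧ ∀ v ∈ W, B (fun e => γ e u) u v = l v := by
  let n := Module.finrank ℝ W
  let β : Module.Basis (Fin n) ℝ W := Module.finBasis ℝ W
  let A : (ι → ℝ) → Matrix (Fin n) (Fin n) ℝ := fun t => Matrix.of fun i j => B t (β j) (β i)
  let rhs : (ι → ℝ) → Fin n → ℝ := fun t i => l (β i) - B t uD (β i)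
  have hAw : ∀ t x i, (A t).mulVec x i = B t (∑ j, x j • (β j : X)) (β i) := by
    intro t x i
    simp [A, Matrix.mulVec, dotProduct, map_sum, mul_comm]
  have hdet : ∀ t ∈ Icc (0 : ι → ℝ) 1, (A t).det ≠ 0 := by
    intro t ht h0
    obtain ⟨x, hx, hAx⟩ := Matrix.exists_mulVec_eq_zero_iff.2 h0
    apply hx
    have h1 : B t (∑ j, x j • (β j : X)) (∑ j, x j • (β j : X)) = 0 := by
      have h0 : ∀ i, B t (∑ j, x j • (β j : X)) (β i) = 0 := fun i => by
        rw [← hAw, hAx, Pi.zero_apply]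
      rw [map_sum]
      exact Finset.sum_eq_zero fun i _ => by rw [map_smul, h0, smul_zero]
    have h2 := hdef t ht _ (W.sum_mem fun j _ => W.smul_mem _ (β j).2) h1
    have h3 : ∑ j, x j • β j = 0 := by
      apply Subtype.ext
      simpa using h2
    funext j
    exact Fintype.linearIndependent_iff.1 β.linearIndependent x h3 j
  let x : (ι → ℝ) → Fin n → ℝ := fun t => ((A t)⁻¹).mulVec (rhs t)
  have hAc : Continuous A := continuous_matrix fun i j => hB _ _
  have hxc : ContinuousOn x (Icc 0 1) := by
    have h1 : ContinuousOn (fun t => (A t)⁻¹) (Icc 0 1) := by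
      simp only [Matrix.inv_def, Ring.inverse_eq_inv']
      exact (hAc.matrix_det.continuousOn.inv₀ hdet).smul hAc.matrix_adjugate.continuousOn
    have h2 : Continuous rhs := continuous_pi fun i => continuous_const.sub (hB _ _)
    rw [continuousOn_iff_continuous_domRestrict] at h1 ⊢
    exact h1.matrix_mulVec (h2.comp continuous_subtype_val)
  let u : (ι → ℝ) → X := fun t => uD + ∑ j, x t j • (β j : X)
  have huc : ContinuousOn u (Icc 0 1) := by
    refine continuousOn_const.add (continuousOn_finsetSum _ fun j _ => ?_)
    exact ((continuous_apply j).comp_continuousOn hxc).smul continuousOn_const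
  obtain ⟨t, ht, hfix⟩ := exists_fixedPoint_cube (fun t e => γ e (u t))
    (fun t _ => ⟨fun e => (hγ e _).1, fun e => (hγ e _).2⟩)
    (continuousOn_pi.2 fun e => (hγc e).comp_continuousOn huc)
  refine ⟨u t, ?_, ?_⟩
  · simp only [u, add_sub_cancel_left]
    exact W.sum_mem fun j _ => W.smul_mem _ (β j).2
  · rw [hfix]
    have hβ : ∀ i, B t (u t) (β i) = l (β i) := by
      intro i
      have h1 : (A t).mulVec (x t) = rhs t := by
        simp only [x]
        rw [Matrix.mulVec_mulVec, Matrix.mul_nonsing_inv _ (isUnit_iff_ne_zero.2 (hdet t ht)),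
          Matrix.one_mulVec]
      have h2 := congrFun h1 i
      rw [hAw] at h2
      simp only [u, map_add, LinearMap.add_apply, h2, rhs]
      ring
    intro v hv
    have h3 : (B t (u t)).comp W.subtype = l.comp W.subtype := β.ext hβ
    exact LinearMap.congr_fun h3 ⟨v, hv⟩

/-! ### Calculus on an element -/

theorem MvPolynomial.contDiff_eval {d : ℕ} (q : MvPolynomial (Fin d) ℝ) {n : WithTop ℕ∞} :
    ContDiff ℝ n fun ξ : Fin d → ℝ => MvPolynomial.eval ξ q := by
  induction q using MvPolynomial.induction_on with
  | C a => simpa using contDiff_const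
  | add p q hp hq => simpa using hp.add hq
  | mul_X p i hp => simpa using hp.mul (contDiff_apply ℝ ℝ i)

theorem MvPolynomial.hasFDerivAt_eval {d : ℕ} (q : MvPolynomial (Fin d) ℝ) (ξ : Fin d → ℝ) :
    HasFDerivAt (fun ξ : Fin d → ℝ => MvPolynomial.eval ξ q)
      (∑ j, MvPolynomial.eval ξ (MvPolynomial.pderiv j q) •
        (ContinuousLinearMap.proj j : (Fin d → ℝ) →L[ℝ] ℝ)) ξ := by
  induction q using MvPolynomial.induction_on with
  | C a =>
    simp only [MvPolynomial.eval_C, MvPolynomial.pderiv_C, map_zero, zero_smul,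
      Finset.sum_const_zero]
    exact hasFDerivAt_const _ _
  | add p q hp hq =>
    simp only [map_add, add_smul, Finset.sum_add_distrib]
    exact hp.add hq
  | mul_X p i hp =>
    have h := hp.mul (hasFDerivAt_apply (𝕜 := ℝ) i ξ)
    have hX : ∀ j, MvPolynomial.eval ξ (MvPolynomial.pderiv j (MvPolynomial.X i)) =
        if j = i then (1 : ℝ) else 0 := fun j => by
      rw [MvPolynomial.pderiv_X, Pi.single_apply, apply_ite (MvPolynomial.eval ξ)]
      simp [eq_comm]
    refine (h.congr_fderiv ?_).congr_of_eventuallyEq (.of_forall fun x => by simp)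
    ext v
    simp only [Derivation.leibniz, smul_eq_mul, map_add, map_mul, MvPolynomial.eval_X, hX,
      add_apply, smul_apply, FunLike.coe_sum, Finset.sum_apply, ContinuousLinearMap.proj_apply,
      Finset.mul_sum, add_mul, Finset.sum_add_distrib]
    congr 1
    · simp
    · exact Finset.sum_congr rfl fun j _ => by ring

theorem isCompact_refCell (d : ℕ) (s : CellShape) : IsCompact (refCell d s) := by
  have hcube : IsCompact (Icc (0 : Fin d → ℝ) 1) := isCompact_Icc
  cases s with
  | simplex =>
    refine hcube.of_isClosed_subset ?_ ?_
    · have h1 : IsClosed {ξ : Fin d → ℝ | ∀ i, 0 ≤ ξ i} := by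
        simp only [ofPred_forall]
        exact isClosed_iInter fun i => isClosed_le continuous_const (continuous_apply i)
      have h2 : IsClosed {ξ : Fin d → ℝ | ∑ i, ξ i ≤ 1} :=
        isClosed_le (continuous_finsetSum _ fun i _ => continuous_apply i) continuous_const
      exact h1.inter h2
    · rintro ξ ⟨h1, h2⟩
      exact ⟨h1, fun i =>
        (Finset.single_le_sum (fun j _ => h1 j) (Finset.mem_univ i)).trans h2⟩
  | cube =>
    convert hcube using 1
    ext ξ
    exact ⟨fun h => ⟨fun i => (h i).1, fun i => (h i).2⟩, fun h i => ⟨h.1 i, h.2 i⟩⟩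

theorem convex_refCell (d : ℕ) (s : CellShape) : Convex ℝ (refCell d s) := by
  cases s with
  | simplex =>
    rintro x ⟨hx1, hx2⟩ y ⟨hy1, hy2⟩ a b ha hb hab
    refine ⟨fun i => add_nonneg (mul_nonneg ha (hx1 i)) (mul_nonneg hb (hy1 i)), ?_⟩
    simp only [Pi.add_apply, Pi.smul_apply, smul_eq_mul, Finset.sum_add_distrib, ← Finset.mul_sum]
    nlinarith
  | cube =>
    intro x hx y hy a b ha hb hab i
    simp only [Pi.add_apply, Pi.smul_apply, smul_eq_mul]
    constructor
    · nlinarith [mul_nonneg ha (hx i).1, mul_nonneg hb (hy i).1]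
    · nlinarith [(hx i).2, (hy i).2]

namespace FECell

variable {d : ℕ} (K : FECell d)

theorem contDiff_map {n : WithTop ℕ∞} : ContDiff ℝ n K.map :=
  contDiff_euclidean.2 fun i => (K.geo i).contDiff_eval

theorem isInvertible_fderiv_map {ξ : Fin d → ℝ} (hξ : ξ ∈ refCell d K.shape) :
    (fderiv ℝ K.map ξ).IsInvertible := by
  have hd : HasFDerivAt K.map (fderiv ℝ K.map ξ) ξ :=
    (K.contDiff_map.differentiable one_ne_zero _).hasFDerivAt
  have hinj : Function.Injective (fderiv ℝ K.map ξ) := by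
    rw [injective_iff_map_eq_zero]
    intro v hv
    apply Matrix.eq_zero_of_mulVec_eq_zero (K.jacobian_ne_zero ξ hξ)
    funext i
    have h1 : HasFDerivAt (fun ξ => K.map ξ i)
        ((EuclideanSpace.proj i : Euc d →L[ℝ] ℝ).comp (fderiv ℝ K.map ξ)) ξ :=
      (EuclideanSpace.proj i : Euc d →L[ℝ] ℝ).hasFDerivAt.comp ξ hd
    have h2 := congrArg (fun L => L v) (h1.unique ((K.geo i).hasFDerivAt_eval ξ))
    simp only [ContinuousLinearMap.comp_apply, hv, map_zero, FunLike.coe_sum,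
      Finset.sum_apply, smul_apply, ContinuousLinearMap.proj_apply,
      smul_eq_mul] at h2
    simp only [Matrix.mulVec, dotProduct, Matrix.of_apply, Pi.zero_apply]
    exact h2.symm
  let e := LinearEquiv.ofInjectiveOfFinrankEq (fderiv ℝ K.map ξ : (Fin d → ℝ) →ₗ[ℝ] Euc d) hinj
    (by simp)
  exact ⟨e.toContinuousLinearEquiv, by ext v; rfl⟩

/-- The image of the interior of the reference element. It is open, and all of the element up to a
null set. -/
def inner : Set (Euc d) := K.map '' interior (refCell d K.shape)

theorem hasStrictFDerivAt_map {ξ : Fin d → ℝ} (hξ : ξ ∈ refCell d K.shape) :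
    ∃ e : (Fin d → ℝ) ≃L[ℝ] Euc d, fderiv ℝ K.map ξ = e ∧
      HasStrictFDerivAt K.map (e : (Fin d → ℝ) →L[ℝ] Euc d) ξ := by
  obtain ⟨e, he⟩ := K.isInvertible_fderiv_map hξ
  exact ⟨e, he.symm, he ▸ K.contDiff_map.contDiffAt.hasStrictFDerivAt one_ne_zero⟩

theorem isOpen_inner : IsOpen K.inner := by
  rw [isOpen_iff_mem_nhds]
  rintro _ ⟨ξ, hξ, rfl⟩
  obtain ⟨e, -, he⟩ := K.hasStrictFDerivAt_map (interior_subset hξ)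
  rw [← he.map_nhds_eq_of_equiv]
  exact image_mem_map (isOpen_interior.mem_nhds hξ)

theorem inner_subset_pts : K.inner ⊆ K.pts := image_mono interior_subset

theorem isCompact_pts : IsCompact K.pts :=
  (isCompact_refCell d K.shape).image (K.contDiff_map (n := 0)).continuous

theorem volume_pts_diff_inner : volume (K.pts \ K.inner) = 0 := by
  have hsub : K.pts \ K.inner ⊆ K.map '' frontier (refCell d K.shape) := by
    rintro _ ⟨⟨ξ, hξ, rfl⟩, h⟩
    refine ⟨ξ, ⟨subset_closure hξ, fun h' => h ⟨ξ, h', rfl⟩⟩, rfl⟩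
  refine measure_mono_null hsub ?_
  have h0 : volume (frontier (refCell d K.shape)) = 0 :=
    (convex_refCell d K.shape).addHaar_frontier volume
  have h1 : volume ((fun ξ => (K.map ξ).ofLp) '' frontier (refCell d K.shape)) = 0 := by
    refine addHaar_image_eq_zero_of_differentiableOn_of_addHaar_eq_zero volume ?_ h0
    intro ξ _
    refine (differentiableAt_pi.2 fun i => ?_).differentiableWithinAt
    exact ((K.geo i).hasFDerivAt_eval ξ).differentiableAt
  have h2 := (PiLp.volume_preserving_ofLp (Fin d)).quasiMeasurePreserving.preimage_null h1
  refine measure_mono_null ?_ h2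
  rintro _ ⟨ξ, hξ, rfl⟩
  exact ⟨ξ, hξ, rfl⟩

theorem exists_abs_le_of_mem_localSpace {p : ℕ} {f : Euc d → ℝ} (hf : f ∈ K.localSpace p) :
    ∃ C, ∀ x ∈ K.pts, |f x| ≤ C := by
  obtain ⟨q, -, hq⟩ := hf
  obtain ⟨C, hC⟩ := (isCompact_refCell d K.shape).exists_bound_of_continuousOn
    (q.contDiff_eval (n := 0)).continuous.continuousOn
  refine ⟨C, ?_⟩
  rintro _ ⟨ξ, hξ, rfl⟩
  rw [hq ξ hξ]
  exact hC ξ hξ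

/-- A finite element function is differentiable inside the element, with bounded derivative: there
it is a polynomial composed with a local inverse of the reference map. -/
theorem exists_fderiv_le_of_mem_localSpace {p : ℕ} {f : Euc d → ℝ} (hf : f ∈ K.localSpace p) :
    ∃ C, ∀ x ∈ K.inner, DifferentiableAt ℝ f x ∧ ‖fderiv ℝ f x‖ ≤ C := by
  obtain ⟨q, -, hq⟩ := hf
  have hcont : ContinuousOn (fun ξ => (fderiv ℝ (fun ξ => MvPolynomial.eval ξ q) ξ).comp
      (fderiv ℝ K.map ξ).inverse) (refCell d K.shape) := by
    have h1 : Continuous (fderiv ℝ fun ξ => MvPolynomial.eval ξ q) :=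
      (q.contDiff_eval (n := 1)).continuous_fderiv one_ne_zero
    have h2 : Continuous (fderiv ℝ K.map) :=
      (K.contDiff_map (n := 1)).continuous_fderiv one_ne_zero
    refine h1.continuousOn.clm_comp fun ξ hξ => ?_
    obtain ⟨e, he, -⟩ := K.hasStrictFDerivAt_map hξ
    have h3 : ContinuousAt ContinuousLinearMap.inverse (fderiv ℝ K.map ξ) := by
      rw [he]
      exact (contDiffAt_map_inverse (n := 0) e).continuousAt
    exact (ContinuousAt.comp h3 h2.continuousAt).continuousWithinAt
  obtain ⟨C, hC⟩ := (isCompact_refCell d K.shape).exists_bound_of_continuousOn hcont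
  refine ⟨C, ?_⟩
  rintro _ ⟨ξ, hξ, rfl⟩
  obtain ⟨e, he, hs⟩ := K.hasStrictFDerivAt_map (interior_subset hξ)
  have hloc : ∀ᶠ y in 𝓝 (K.map ξ),
      f y = MvPolynomial.eval (hs.localInverse K.map e ξ y) q := by
    have hmem : ∀ᶠ y in 𝓝 (K.map ξ), hs.localInverse K.map e ξ y ∈ interior (refCell d K.shape) :=
      hs.localInverse_tendsto (isOpen_interior.mem_nhds hξ)
    filter_upwards [hs.eventually_right_inverse, hmem] with y hy hy'
    rw [← hq _ (interior_subset hy'), hy]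
  have hder : HasFDerivAt f ((fderiv ℝ (fun ξ => MvPolynomial.eval ξ q) ξ).comp
      (fderiv ℝ K.map ξ).inverse) (K.map ξ) := by
    rw [he, ContinuousLinearMap.inverse_equiv]
    refine HasFDerivAt.congr_of_eventuallyEq ?_ hloc
    have h1 : HasFDerivAt (fun ξ => MvPolynomial.eval ξ q)
        (fderiv ℝ (fun ξ => MvPolynomial.eval ξ q) ξ) (hs.localInverse K.map e ξ (K.map ξ)) := by
      rw [hs.localInverse_apply_image]
      exact ((q.contDiff_eval (n := 1)).differentiable one_ne_zero _).hasFDerivAt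
    exact h1.comp _ hs.to_localInverse.hasFDerivAt
  refine ⟨hder.differentiableAt, ?_⟩
  rw [hder.fderiv]
  exact hC ξ (interior_subset hξ)

end FECell

/-! ### Bounded functions and `L²` products -/

section General

variable {d : ℕ}

theorem gradient_apply (f : Euc d → ℝ) (x : Euc d) (i : Fin d) :
    gradient f x i = fderiv ℝ f x (EuclideanSpace.single i 1) := by
  have h := InnerProductSpace.toDual_symm_apply (𝕜 := ℝ) (x := EuclideanSpace.single i (1 : ℝ))
    (y := fderiv ℝ f x)
  rw [← h, real_inner_comm, EuclideanSpace.inner_single_left]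
  simp [gradient]

theorem norm_gradient (f : Euc d → ℝ) (x : Euc d) : ‖gradient f x‖ = ‖fderiv ℝ f x‖ :=
  LinearIsometryEquiv.norm_map _ _

theorem measurable_gradient (f : Euc d → ℝ) : Measurable (gradient f) :=
  (InnerProductSpace.toDual ℝ (Euc d)).symm.continuous.measurable.comp (measurable_fderiv ℝ f)

theorem integrable_inner_of_memLp_two {α E : Type*} [MeasurableSpace α] {μ : Measure α}
    [NormedAddCommGroup E] [InnerProductSpace ℝ E] {F G : α → E} (hF : MemLp F 2 μ)
    (hG : MemLp G 2 μ) : Integrable (fun x => inner ℝ (F x) (G x)) μ := by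
  refine (hF.norm.integrable_mul hG.norm).mono (hF.1.inner hG.1) (.of_forall fun x => ?_)
  rw [Pi.mul_apply, Real.norm_eq_abs (_ * _), abs_of_nonneg (by positivity)]
  exact norm_inner_le_norm _ _

theorem memLp_top_restrict_mono {E : Type*} [NormedAddCommGroup E] {A B : Set (Euc d)} {q : ℝ≥0∞}
    {F : Euc d → E} (hF : MemLp F q (volume.restrict B)) (h : A ⊆ B) :
    MemLp F q (volume.restrict A) :=
  hF.mono_measure (Measure.restrict_mono h le_rfl)

theorem innerL2_comm (A : Set (Euc d)) (F G : Euc d → Euc d) : innerL2 A F G = innerL2 A G F := by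
  simp only [innerL2, real_inner_comm]

theorem innerL2_self (A : Set (Euc d)) (G : Euc d → Euc d) : innerL2 A G G = normL2 A G ^ 2 := by
  simp only [innerL2, normL2, real_inner_self_eq_norm_sq]
  rw [Real.sq_sqrt (by positivity)]

theorem innerL2_congr {A : Set (Euc d)} {F F' G G' : Euc d → Euc d}
    (h : F =ᵐ[volume.restrict A] F') (h' : G =ᵐ[volume.restrict A] G') :
    innerL2 A F G = innerL2 A F' G' := by
  apply integral_congr_ae
  filter_upwards [h, h'] with x hx hx'
  rw [hx, hx']

theorem innerL2_add_smul_left {A : Set (Euc d)} {F F' G : Euc d → Euc d}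
    (hF : MemLp F 2 (volume.restrict A)) (hF' : MemLp F' 2 (volume.restrict A))
    (hG : MemLp G 2 (volume.restrict A)) (c : ℝ) :
    innerL2 A (F + c • F') G = innerL2 A F G + c * innerL2 A F' G := by
  simp only [innerL2, Pi.add_apply, Pi.smul_apply, inner_add_left, real_inner_smul_left]
  rw [integral_add (integrable_inner_of_memLp_two hF hG)
    ((integrable_inner_of_memLp_two hF' hG).const_mul c), integral_const_mul]

/-- A bilinear form, from a map that respects the linear combinations `u + c • u'` in both
arguments. -/
theorem exists_bilinear_of_add_smul {X : Type*} [AddCommGroup X] [Module ℝ X] (f : X → X → ℝ)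
    (h1 : ∀ u u' v (c : ℝ), f (u + c • u') v = f u v + c * f u' v)
    (h2 : ∀ u v v' (c : ℝ), f u (v + c • v') = f u v + c * f u v') :
    ∃ B : X →ₗ[ℝ] X →ₗ[ℝ] ℝ, ∀ u v, B u v = f u v := by
  have z1 : ∀ v, f 0 v = 0 := fun v => by
    have := h1 0 0 v 1
    simp only [smul_zero, add_zero, one_mul] at this
    linarith
  have z2 : ∀ u, f u 0 = 0 := fun u => by
    have := h2 u 0 0 1
    simp only [smul_zero, add_zero, one_mul] at this
    linarith
  refine ⟨LinearMap.mk₂ ℝ f (fun u u' v => ?_) (fun c u v => ?_) (fun u v v' => ?_)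
    (fun c u v => ?_), fun u v => rfl⟩
  · simpa using h1 u u' v 1
  · simpa [z1] using h1 0 u v c
  · simpa using h2 u v v' 1
  · simpa [z2] using h2 u 0 v c

end General

theorem FECell.memLp_top_of_mem_localSpace {d : ℕ} (K : FECell d) {p : ℕ} {f : Euc d → ℝ}
    (hf : f ∈ K.localSpace p) : MemLp f ∞ (volume.restrict K.pts) := by
  obtain ⟨C, hC⟩ := K.exists_abs_le_of_mem_localSpace hf
  obtain ⟨D, hD⟩ := K.exists_fderiv_le_of_mem_localSpace hf
  have hmeas : AEStronglyMeasurable f (volume.restrict K.pts) := by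
    have h1 : AEStronglyMeasurable f (volume.restrict K.inner) :=
      ContinuousOn.aestronglyMeasurable
        (fun x hx => (hD x hx).1.continuousAt.continuousWithinAt) K.isOpen_inner.measurableSet
    have h2 : AEStronglyMeasurable f (volume.restrict (K.pts \ K.inner)) := by
      rw [Measure.restrict_eq_zero.2 K.volume_pts_diff_inner]
      exact aestronglyMeasurable_zero_measure f
    have h3 := aestronglyMeasurable_union_iff.2 ⟨h1, h2⟩
    rwa [union_sdiff_cancel K.inner_subset_pts] at h3
  exact memLp_top_of_bound hmeas C
    ((ae_restrict_iff' K.isCompact_pts.measurableSet).2 (.of_forall hC))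

/-! ### Finite element functions on the mesh -/

section ExtZero

variable {d : ℕ} {Ω : Set (Euc d)}

theorem extZero_of_notMem (u : C(closure Ω, ℝ)) {x : Euc d} (hx : x ∉ closure Ω) :
    extZero u x = 0 :=
  Function.extend_apply' _ _ _ fun ⟨y, hy⟩ => hx (hy ▸ y.2)

theorem extZero_add_smul (u v : C(closure Ω, ℝ)) (c : ℝ) :
    extZero (u + c • v) = extZero u + c • extZero v := by
  funext x
  by_cases hx : x ∈ closure Ω
  · simp [extZero_apply _ hx]
  · simp [extZero_of_notMem _ hx]

theorem continuousOn_extZero (u : C(closure Ω, ℝ)) : ContinuousOn (extZero u) (closure Ω) := by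
  rw [continuousOn_iff_continuous_domRestrict]
  convert u.continuous using 1
  funext x
  exact extZero_apply u x.2

theorem memLp_top_extZero (hΩ : Bornology.IsBounded Ω) (u : C(closure Ω, ℝ)) :
    MemLp (extZero u) ∞ (volume.restrict (closure Ω)) := by
  have hcomp : IsCompact (closure Ω) := hΩ.isCompact_closure
  obtain ⟨C, hC⟩ := hcomp.exists_bound_of_continuousOn (continuousOn_extZero u)
  exact memLp_top_of_bound
    ((continuousOn_extZero u).aestronglyMeasurable hcomp.measurableSet) C
    ((ae_restrict_iff' hcomp.measurableSet).2 (.of_forall hC))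

end ExtZero

namespace FEMesh

variable {d : ℕ} {Ω : Set (Euc d)} {ι : Type*} [Fintype ι] (T : FEMesh Ω ι) {p : ℕ}

theorem pts_subset_closure (e : ι) : (T.cell e).pts ⊆ closure Ω :=
  T.cover ▸ subset_iUnion (fun e => (T.cell e).pts) e

theorem inner_subset_interior_closure (e : ι) : (T.cell e).inner ⊆ interior (closure Ω) :=
  interior_maximal ((T.cell e).inner_subset_pts.trans (T.pts_subset_closure e))
    (T.cell e).isOpen_inner

theorem ae_exists_mem_inner :
    ∀ᵐ x ∂volume.restrict (closure Ω), ∃ e, x ∈ (T.cell e).inner := by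
  have h : ∀ᵐ x ∂(volume : Measure (Euc d)), ∀ e, x ∉ (T.cell e).pts \ (T.cell e).inner :=
    ae_all_iff.2 fun e => measure_eq_zero_iff_ae_notMem.1 (T.cell e).volume_pts_diff_inner
  rw [ae_restrict_iff' isClosed_closure.measurableSet]
  filter_upwards [h] with x hx hxΩ
  rw [← T.cover] at hxΩ
  obtain ⟨e, he⟩ := mem_iUnion.1 hxΩ
  exact ⟨e, by_contra fun h => hx e ⟨he, h⟩⟩

theorem ae_differentiableAt {u : C(closure Ω, ℝ)} (hu : u ∈ T.space p) :
    ∀ᵐ x ∂volume.restrict (closure Ω), DifferentiableAt ℝ (extZero u) x := by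
  filter_upwards [T.ae_exists_mem_inner] with x ⟨e, hx⟩
  obtain ⟨C, hC⟩ := (T.cell e).exists_fderiv_le_of_mem_localSpace (hu e)
  exact (hC x hx).1

theorem memLp_top_grad {u : C(closure Ω, ℝ)} (hu : u ∈ T.space p) :
    MemLp (grad u) ∞ (volume.restrict (closure Ω)) := by
  choose C hC using fun e => (T.cell e).exists_fderiv_le_of_mem_localSpace (hu e)
  refine memLp_top_of_bound (measurable_gradient _).aestronglyMeasurable (∑ e, |C e|) ?_
  filter_upwards [T.ae_exists_mem_inner] with x ⟨e, hx⟩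
  rw [grad, norm_gradient]
  exact ((hC e x hx).2.trans (le_abs_self _)).trans
    (Finset.single_le_sum (f := fun e => |C e|) (fun _ _ => abs_nonneg _) (Finset.mem_univ e))

theorem grad_add_smul_ae {u v : C(closure Ω, ℝ)} (hu : u ∈ T.space p) (hv : v ∈ T.space p)
    (c : ℝ) : grad (u + c • v) =ᵐ[volume.restrict (closure Ω)] grad u + c • grad v := by
  filter_upwards [T.ae_differentiableAt hu, T.ae_differentiableAt hv] with x hux hvx
  simp only [grad, gradient, extZero_add_smul, Pi.add_apply, Pi.smul_apply]
  rw [fderiv_add hux (hvx.const_smul c), fderiv_const_smul hvx]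
  simp

theorem finiteDimensional_space : FiniteDimensional ℝ (T.space p) := by
  let E : ∀ s : CellShape, polySpace d s p →ₗ[ℝ] (refCell d s → ℝ) := fun s =>
    { toFun := fun q ξ => MvPolynomial.eval ξ.1 q.1
      map_add' := fun q q' => by ext ξ; simp
      map_smul' := fun c q => by ext ξ; simp [MvPolynomial.smul_eval] }
  have hfin : ∀ s, FiniteDimensional ℝ (polySpace d s p) := by
    rintro (_ | _)
    · exact inferInstanceAs (Module.Finite ℝ (MvPolynomial.restrictTotalDegree (Fin d) ℝ p))
    · exact inferInstanceAs (Module.Finite ℝ (MvPolynomial.restrictDegree (Fin d) ℝ p))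
  -- a finite element function is determined by its pull-backs to the reference elements
  let P : T.space p →ₗ[ℝ] ∀ e, LinearMap.range (E (T.cell e).shape) :=
    { toFun := fun u e => ⟨fun ξ => extZero u.1 ((T.cell e).map ξ.1), by
        obtain ⟨q, hq, h⟩ := u.2 e
        exact ⟨⟨q, hq⟩, by ext ξ; exact (h ξ.1 ξ.2).symm⟩⟩
      map_add' := fun u v => by
        funext e
        ext ξ
        have := congrFun (extZero_add_smul u.1 v.1 1) ((T.cell e).map ξ.1)
        simpa using this
      map_smul' := fun c u => by
        funext e
        ext ξ
        have := congrFun (extZero_add_smul 0 u.1 c) ((T.cell e).map ξ.1)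
        have h0 : extZero (0 : C(closure Ω, ℝ)) ((T.cell e).map ξ.1) = 0 :=
          extZero_apply 0 (T.map_mem_closure e ξ.2)
        simpa [h0] using this }
  have hP : Function.Injective P := by
    intro u v h
    ext x
    obtain ⟨e, ξ, hξ, hxξ⟩ := mem_iUnion.1 (T.cover.superset x.2)
    have h1 := congrFun (congrArg Subtype.val (congrFun h e)) ⟨ξ, hξ⟩
    have h2 : extZero u.1 x = extZero v.1 x := by
      rw [← hxξ]
      exact h1
    rwa [extZero_apply _ x.2, extZero_apply _ x.2] at h2
  exact FiniteDimensional.of_injective P hP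

/-! ### The fluctuation operator and the bilinear forms -/

theorem dual_mem_localSpace (e : ι) (a : Euc d) : T.dual p e a ∈ (T.cell e).localSpace p := by
  unfold dual
  split_ifs with h
  · exact h.choose_spec.1
  · exact ⟨0, zero_mem _, fun ξ _ => by simp⟩

variable (sel : Euc d → ι)

theorem integrable_dual_mul (e : ι) (a : Euc d) {v : Euc d → ℝ}
    (hv : MemLp v ∞ (volume.restrict (closure Ω))) :
    Integrable (fun x => T.dual p e a x * v x) (volume.restrict (T.cell e).pts) := by
  have : IsFiniteMeasure (volume.restrict (T.cell e).pts) :=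
    isFiniteMeasure_restrict.2 (T.cell e).isCompact_pts.measure_lt_top.ne
  have h1 := (T.cell e).memLp_top_of_mem_localSpace (T.dual_mem_localSpace (p := p) e a)
  have h2 := memLp_top_restrict_mono hv (T.pts_subset_closure e)
  exact (h1.mono_exponent le_top).integrable_mul (p := 2) (q := 2) (h2.mono_exponent le_top)

theorem scottZhang_add_smul {v w : Euc d → ℝ}
    (hv : MemLp v ∞ (volume.restrict (closure Ω))) (hw : MemLp w ∞ (volume.restrict (closure Ω)))
    (c : ℝ) :
    T.scottZhang p sel (v + c • w) = T.scottZhang p sel v + c • T.scottZhang p sel w := by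
  simp only [scottZhang, Finset.smul_sum, ← Finset.sum_add_distrib]
  refine Finset.sum_congr rfl fun a _ => ?_
  rw [smul_smul, ← add_smul, ← integral_const_mul, ← integral_add
    (T.integrable_dual_mul _ _ hv) ((T.integrable_dual_mul _ _ hw).const_mul c)]
  congr 1
  refine integral_congr_ae (.of_forall fun x => ?_)
  simp only [Pi.add_apply, Pi.smul_apply, smul_eq_mul]
  ring

theorem scottZhang_congr {v w : Euc d → ℝ} (h : v =ᵐ[volume.restrict (closure Ω)] w) :
    T.scottZhang p sel v = T.scottZhang p sel w := by
  simp only [scottZhang]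
  refine Finset.sum_congr rfl fun a _ => ?_
  congr 1
  apply integral_congr_ae
  filter_upwards [ae_restrict_of_ae_restrict_of_subset (T.pts_subset_closure (sel a)) h] with x hx
  rw [hx]

theorem fluct_congr {F G : Euc d → Euc d} (h : F =ᵐ[volume.restrict (closure Ω)] G) :
    T.fluct p sel F =ᵐ[volume.restrict (closure Ω)] T.fluct p sel G := by
  filter_upwards [h] with x hx
  ext i
  have : T.scottZhang p sel (fun y => F y i) = T.scottZhang p sel fun y => G y i :=
    T.scottZhang_congr sel (h.mono fun y hy => by simp only [hy])
  simp only [fluct, hx, this]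

theorem fluct_add_smul {F G : Euc d → Euc d}
    (hF : MemLp F ∞ (volume.restrict (closure Ω))) (hG : MemLp G ∞ (volume.restrict (closure Ω)))
    (c : ℝ) : T.fluct p sel (F + c • G) = T.fluct p sel F + c • T.fluct p sel G := by
  funext x
  ext i
  have h := T.scottZhang_add_smul (p := p) sel (hF.eval_piLp i) (hG.eval_piLp i) c
  have h' : T.scottZhang p sel (fun y => (F + c • G) y i) =
      T.scottZhang p sel (fun y => F y i) + c • T.scottZhang p sel fun y => G y i := h
  change F x i + c * G x i - extZero (T.scottZhang p sel fun y => (F + c • G) y i) x =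
    F x i - extZero (T.scottZhang p sel fun y => F y i) x +
      c * (G x i - extZero (T.scottZhang p sel fun y => G y i) x)
  rw [h', extZero_add_smul, Pi.add_apply, Pi.smul_apply, smul_eq_mul]
  ring

theorem memLp_top_fluct (hΩ : Bornology.IsBounded Ω) {F : Euc d → Euc d}
    (hF : MemLp F ∞ (volume.restrict (closure Ω))) :
    MemLp (T.fluct p sel F) ∞ (volume.restrict (closure Ω)) :=
  MemLp.of_eval_piLp fun i => (hF.eval_piLp i).sub (memLp_top_extZero hΩ _)

variable {sel}

theorem memLp_two_of_top (hΩ : Bornology.IsBounded Ω) {E : Type*} [NormedAddCommGroup E]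
    {A : Set (Euc d)} (hA : A ⊆ closure Ω) {F : Euc d → E}
    (hF : MemLp F ∞ (volume.restrict (closure Ω))) : MemLp F 2 (volume.restrict A) := by
  have : IsFiniteMeasure (volume.restrict (closure Ω)) :=
    isFiniteMeasure_restrict.2 hΩ.isCompact_closure.measure_lt_top.ne
  exact memLp_top_restrict_mono (hF.mono_exponent le_top) hA

theorem innerL2_grad_add_smul_left (hΩ : Bornology.IsBounded Ω) {A : Set (Euc d)}
    (hA : A ⊆ closure Ω) {u u' v : C(closure Ω, ℝ)} (hu : u ∈ T.space p) (hu' : u' ∈ T.space p)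
    (hv : v ∈ T.space p) (c : ℝ) :
    innerL2 A (grad (u + c • u')) (grad v) =
      innerL2 A (grad u) (grad v) + c * innerL2 A (grad u') (grad v) := by
  rw [← innerL2_add_smul_left (memLp_two_of_top hΩ hA (T.memLp_top_grad hu))
    (memLp_two_of_top hΩ hA (T.memLp_top_grad hu')) (memLp_two_of_top hΩ hA (T.memLp_top_grad hv))]
  exact innerL2_congr (ae_restrict_of_ae_restrict_of_subset hA (T.grad_add_smul_ae hu hu' c))
    .rfl

theorem fluctForm_comm (e : ι) (u v : C(closure Ω, ℝ)) :
    T.fluctForm p sel e u v = T.fluctForm p sel e v u :=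
  innerL2_comm _ _ _

theorem fluctForm_add_smul_left (hΩ : Bornology.IsBounded Ω) (e : ι) {u u' v : C(closure Ω, ℝ)}
    (hu : u ∈ T.space p) (hu' : u' ∈ T.space p) (hv : v ∈ T.space p) (c : ℝ) :
    T.fluctForm p sel e (u + c • u') v =
      T.fluctForm p sel e u v + c * T.fluctForm p sel e u' v := by
  have hA := T.pts_subset_closure e
  have hf : ∀ {w}, w ∈ T.space p → MemLp (T.fluct p sel (grad w)) 2
      (volume.restrict (T.cell e).pts) := fun hw =>
    memLp_two_of_top hΩ hA (T.memLp_top_fluct sel hΩ (T.memLp_top_grad hw))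
  unfold fluctForm
  rw [← innerL2_add_smul_left (hf hu) (hf hu') (hf hv),
    ← T.fluct_add_smul sel (T.memLp_top_grad hu) (T.memLp_top_grad hu')]
  exact innerL2_congr (ae_restrict_of_ae_restrict_of_subset hA
    (T.fluct_congr sel (T.grad_add_smul_ae hu hu' c))) .rfl

theorem patch_subset_interior_closure (e : ι) : T.patch e ⊆ interior (closure Ω) :=
  interior_mono (iUnion₂_subset fun e' _ => T.pts_subset_closure e')

theorem patch_subset_closure (e : ι) : T.patch e ⊆ closure Ω :=
  (T.patch_subset_interior_closure e).trans interior_subset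

end FEMesh

/-! ### Test functions and `H¹₀` -/

/-- A domain with Lipschitz boundary lies on one side of its boundary. -/
theorem HasLipschitzBoundary.interior_closure {d : ℕ} {Ω : Set (Euc d)}
    (h : HasLipschitzBoundary Ω) (hΩ : IsOpen Ω) : interior (closure Ω) = Ω := by
  refine Subset.antisymm (fun x hx => ?_) (interior_maximal subset_closure hΩ)
  by_contra hxΩ
  have hfr : x ∈ frontier Ω := by
    rw [frontier, hΩ.interior_eq]
    exact ⟨interior_subset hx, hxΩ⟩
  obtain ⟨n, r, L, f, hn, hr, hf, hfn, hball⟩ := h x hfr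
  have hfx : inner ℝ n x ≤ f x := by
    by_contra! hcon
    exact hxΩ ((hball x (Metric.mem_ball_self hr)).2 hcon)
  have hlim : Tendsto (fun t : ℝ => x + (-t) • n) (𝓝[>] 0) (𝓝 x) := by
    have : Continuous fun t : ℝ => x + (-t) • n := by fun_prop
    have h0 := this.tendsto 0
    simp only [neg_zero, zero_smul, add_zero] at h0
    exact h0.mono_left nhdsWithin_le_nhds
  have hev : ∀ᶠ t in 𝓝[>] (0 : ℝ), x + (-t) • n ∈ interior (closure Ω) ∩ Metric.ball x r :=
    hlim (Filter.inter_mem (isOpen_interior.mem_nhds hx) (Metric.ball_mem_nhds x hr))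
  obtain ⟨t, ⟨ht1, ht2⟩, ht⟩ := (hev.and self_mem_nhdsWithin).exists
  have ht : 0 < t := ht
  -- near `x - t n` there are no points of `Ω`
  have hopen : IsOpen (Metric.ball x r ∩ {z | inner ℝ n z < f z}) :=
    Metric.isOpen_ball.inter (isOpen_lt (by fun_prop) hf.continuous)
  have hmem : x + (-t) • n ∈ Metric.ball x r ∩ {z | inner ℝ n z < f z} := by
    refine ⟨ht2, ?_⟩
    have h1 := hfn x (-t)
    simp only [mem_ofPred_eq, h1, inner_add_right, inner_smul_right, real_inner_self_eq_norm_sq, hn]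
    linarith
  obtain ⟨z, ⟨hz1, hz2⟩, hz⟩ := mem_closure_iff.1 (interior_subset ht1) _ hopen hmem
  exact absurd ((hball z hz1).1 hz) (not_lt.2 (le_of_lt hz2))

namespace IsTestFun

variable {d : ℕ} {U : Set (Euc d)} {φ : Euc d → ℝ}

theorem differentiable (h : IsTestFun U φ) : Differentiable ℝ φ :=
  h.1.differentiable (by simp)

theorem mono (h : IsTestFun U φ) {V : Set (Euc d)} (hUV : U ⊆ V) : IsTestFun V φ :=
  ⟨h.1, h.2.1, h.2.2.trans hUV⟩

theorem mul (h : IsTestFun U φ) {χ : Euc d → ℝ} (hχ : IsTestFun U χ) :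
    IsTestFun U (fun x => φ x * χ x) :=
  ⟨h.1.mul hχ.1, h.2.1.mul_right, (tsupport_mul_subset_left).trans h.2.2⟩

theorem add_smul (h : IsTestFun U φ) {χ : Euc d → ℝ} (hχ : IsTestFun U χ) (c : ℝ) :
    IsTestFun U (φ + c • χ) := by
  have h1 : tsupport (c • χ) ⊆ tsupport χ := closure_mono (Function.support_const_smul_subset c χ)
  refine ⟨h.1.add (hχ.1.const_smul c), h.2.1.add (hχ.2.1.smul_left), ?_⟩
  exact (tsupport_add φ (c • χ)).trans (union_subset h.2.2 (h1.trans hχ.2.2))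

theorem memLp (h : IsTestFun U φ) {q : ℝ≥0∞} {A : Set (Euc d)} :
    MemLp φ q (volume.restrict A) :=
  h.1.continuous.memLp_of_hasCompactSupport h.2.1

theorem continuous_gradient (h : IsTestFun U φ) : Continuous (gradient φ) :=
  (InnerProductSpace.toDual ℝ (Euc d)).symm.continuous.comp
    (h.1.continuous_fderiv (by simp))

theorem gradient_of_notMem (h : IsTestFun U φ) {x : Euc d} (hx : x ∉ U) : gradient φ x = 0 := by
  rw [gradient, fderiv_of_notMem_tsupport ℝ fun h' => hx (h.2.2 h'), map_zero]

theorem eq_zero_of_notMem (h : IsTestFun U φ) {x : Euc d} (hx : x ∉ U) : φ x = 0 :=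
  image_eq_zero_of_notMem_tsupport fun h' => hx (h.2.2 h')

theorem memLp_gradient (h : IsTestFun U φ) {q : ℝ≥0∞} {A : Set (Euc d)} :
    MemLp (gradient φ) q (volume.restrict A) :=
  h.continuous_gradient.memLp_of_hasCompactSupport
    ((h.2.1.fderiv ℝ).comp_left (g := (InnerProductSpace.toDual ℝ (Euc d)).symm) (map_zero _))

theorem gradient_add_smul (h : IsTestFun U φ) {χ : Euc d → ℝ} (hχ : IsTestFun U χ) (c : ℝ) :
    gradient (φ + c • χ) = gradient φ + c • gradient χ := by
  funext x
  simp only [gradient, Pi.add_apply, Pi.smul_apply]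
  rw [fderiv_add (h.differentiable x) ((hχ.differentiable x).const_smul c),
    fderiv_const_smul (hχ.differentiable x)]
  simp

theorem gradient_mul_self (h : IsTestFun U φ) (x : Euc d) :
    gradient (fun x => φ x * φ x) x = (2 * φ x) • gradient φ x := by
  ext i
  rw [PiLp.smul_apply, gradient_apply, gradient_apply,
    fderiv_fun_mul (h.differentiable x) (h.differentiable x)]
  simp only [add_apply, smul_apply, smul_eq_mul]
  ring

end IsTestFun

theorem integrable_mul_of_memLp_two {α : Type*} [MeasurableSpace α] {μ : Measure α} {f g : α → ℝ}
    (hf : MemLp f 2 μ) (hg : MemLp g 2 μ) : Integrable (fun x => f x * g x) μ :=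
  hf.integrable_mul (p := 2) (q := 2) hg

theorem IsH1.add_smul {d : ℕ} {U : Set (Euc d)} {v w : Euc d → ℝ} {G H : Euc d → Euc d}
    (hv : IsH1 U v G) (hw : IsH1 U w H) (c : ℝ) : IsH1 U (v + c • w) (G + c • H) := by
  refine ⟨hv.1.add (hw.1.const_smul c), hv.2.1.add (hw.2.1.const_smul c), fun φ hφ i => ?_⟩
  have h1 : ∀ {v : Euc d → ℝ}, MemLp v 2 (volume.restrict U) →
      Integrable (fun x => v x * gradient φ x i) (volume.restrict U) := fun hv =>
    integrable_mul_of_memLp_two hv (hφ.memLp_gradient.eval_piLp i)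
  have h2 : ∀ {G : Euc d → Euc d}, MemLp G 2 (volume.restrict U) →
      Integrable (fun x => G x i * φ x) (volume.restrict U) := fun hG =>
    integrable_mul_of_memLp_two (hG.eval_piLp i) hφ.memLp
  have e1 : ∀ x, (v + c • w) x * gradient φ x i =
      v x * gradient φ x i + c * (w x * gradient φ x i) := fun x => by
    simp only [Pi.add_apply, Pi.smul_apply, smul_eq_mul]; ring
  have e2 : ∀ x, (G + c • H) x i * φ x = G x i * φ x + c * (H x i * φ x) := fun x => by
    simp only [Pi.add_apply, Pi.smul_apply, smul_eq_mul, PiLp.add_apply, PiLp.smul_apply]; ring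
  simp only [e1, e2]
  rw [integral_add (h1 hv.1) ((h1 hw.1).const_mul c), integral_const_mul,
    integral_add (h2 hv.2.1) ((h2 hw.2.1).const_mul c), integral_const_mul,
    hv.2.2 φ hφ i, hw.2.2 φ hφ i]
  ring

theorem tendsto_eLpNorm_add_smul {α E : Type*} [MeasurableSpace α] {μ : Measure α}
    [NormedAddCommGroup E] [NormedSpace ℝ E] {F G : ℕ → α → E}
    (hF : ∀ n, AEStronglyMeasurable (F n) μ) (hG : ∀ n, AEStronglyMeasurable (G n) μ) (c : ℝ)
    (h : Tendsto (fun n => eLpNorm (F n) 2 μ) atTop (𝓝 0))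
    (h' : Tendsto (fun n => eLpNorm (G n) 2 μ) atTop (𝓝 0)) :
    Tendsto (fun n => eLpNorm (F n + c • G n) 2 μ) atTop (𝓝 0) := by
  have h2 : Tendsto (fun n => eLpNorm (F n) 2 μ + ‖c‖ₑ * eLpNorm (G n) 2 μ) atTop (𝓝 0) := by
    simpa using h.add (ENNReal.Tendsto.const_mul h' (Or.inr enorm_ne_top))
  refine tendsto_of_tendsto_of_tendsto_of_le_of_le tendsto_const_nhds h2 (fun n => zero_le) ?_
  intro n
  refine (eLpNorm_add_le (hF n) ((hG n).const_smul c) one_le_two).trans ?_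
  rw [eLpNorm_const_smul]

theorem IsH10.add_smul {d : ℕ} {U : Set (Euc d)} {v w : Euc d → ℝ} (hv : IsH10 U v)
    (hw : IsH10 U w) (c : ℝ) : IsH10 U (v + c • w) := by
  obtain ⟨G, hG, φ, hφ, hφ1, hφ2⟩ := hv
  obtain ⟨H, hH, χ, hχ, hχ1, hχ2⟩ := hw
  refine ⟨G + c • H, hG.add_smul hH c, fun n => φ n + c • χ n, fun n => (hφ n).add_smul (hχ n) c,
    ?_, ?_⟩
  · convert tendsto_eLpNorm_add_smul (fun n => hG.1.1.sub ((hφ n).memLp (q := 2)).1)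
      (fun n => hH.1.1.sub ((hχ n).memLp (q := 2)).1) c hφ1 hχ1 using 3 with n
    funext x
    change v x + c * w x - (φ n x + c * χ n x) = v x - φ n x + c * (w x - χ n x)
    ring
  · convert tendsto_eLpNorm_add_smul (fun n => hG.2.1.1.sub ((hφ n).memLp_gradient (q := 2)).1)
      (fun n => hH.2.1.1.sub ((hχ n).memLp_gradient (q := 2)).1) c hφ2 hχ2 using 3 with n
    funext x
    rw [(hφ n).gradient_add_smul (hχ n)]
    change G x + c • H x - (gradient (φ n) x + c • gradient (χ n) x) =
      G x - gradient (φ n) x + c • (H x - gradient (χ n) x)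
    module

theorem isH10_zero {d : ℕ} {U : Set (Euc d)} : IsH10 U (0 : Euc d → ℝ) := by
  have hg : gradient (0 : Euc d → ℝ) = 0 := by
    funext x
    simp [gradient]
  refine ⟨0, ⟨MemLp.zero, MemLp.zero, fun φ _ i => by simp⟩, fun _ => 0, fun _ =>
    ⟨contDiff_const, HasCompactSupport.zero, by simp [tsupport]⟩, ?_, ?_⟩
  · simp
  · simp [hg]

/-! ### Weak and classical gradients -/

/-- In the `L²` inner product, limits may be taken in both factors. -/
theorem tendsto_integral_inner {α E : Type*} [MeasurableSpace α] {μ : Measure α}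
    [NormedAddCommGroup E] [InnerProductSpace ℝ E] {F G : α → E} {Fn Gn : ℕ → α → E}
    (hF : MemLp F 2 μ) (hG : MemLp G 2 μ) (hFn : ∀ n, MemLp (Fn n) 2 μ)
    (hGn : ∀ n, MemLp (Gn n) 2 μ)
    (h : Tendsto (fun n => eLpNorm (F - Fn n) 2 μ) atTop (𝓝 0))
    (h' : Tendsto (fun n => eLpNorm (G - Gn n) 2 μ) atTop (𝓝 0)) :
    Tendsto (fun n => ∫ x, inner ℝ (Fn n x) (Gn n x) ∂μ) atTop
      (𝓝 (∫ x, inner ℝ (F x) (G x) ∂μ)) := by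
  have key : ∀ {F : α → E} {Fn : ℕ → α → E} (hF : MemLp F 2 μ) (hFn : ∀ n, MemLp (Fn n) 2 μ),
      Tendsto (fun n => eLpNorm (F - Fn n) 2 μ) atTop (𝓝 0) →
      Tendsto (fun n => (hFn n).toLp (Fn n)) atTop (𝓝 (hF.toLp F)) := by
    intro F Fn hF hFn h
    refine (Lp.tendsto_Lp_iff_tendsto_eLpNorm'' Fn hFn F hF).2 (h.congr fun n => ?_)
    exact eLpNorm_sub_comm _ _ _ _
  have hinner : ∀ {F G : α → E} (hF : MemLp F 2 μ) (hG : MemLp G 2 μ),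
      inner ℝ (hF.toLp F) (hG.toLp G) = ∫ x, inner ℝ (F x) (G x) ∂μ := by
    intro F G hF hG
    rw [L2.inner_def]
    apply integral_congr_ae
    filter_upwards [hF.coeFn_toLp, hG.coeFn_toLp] with x hx hx'
    rw [hx, hx']
  have := (key hF hFn h).inner (𝕜 := ℝ) (key hG hGn h')
  simpa only [hinner] using this

/-- `(b · ∇v, v) = -(1/2) (div b, v²)` for `v ∈ H¹₀`: if `v` is a test function, `v²` is one, and
this is the definition of the weak divergence. -/
theorem integral_convection_of_isH10 {d : ℕ} {Ω : Set (Euc d)} (hΩ : Bornology.IsBounded Ω)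
    {b : Euc d → Euc d} {Db : Fin d → Euc d → Euc d} (hb : IsW1inf Ω b Db) {v : Euc d → ℝ}
    {G : Euc d → Euc d} (hv : IsH1 Ω v G) {φ : ℕ → Euc d → ℝ} (hφ : ∀ n, IsTestFun Ω (φ n))
    (h1 : Tendsto (fun n => eLpNorm (fun x => v x - φ n x) 2 (volume.restrict Ω)) atTop (𝓝 0))
    (h2 : Tendsto (fun n => eLpNorm (fun x => G x - gradient (φ n) x) 2 (volume.restrict Ω))
      atTop (𝓝 0)) :
    ∫ x in Ω, inner ℝ (b x) (G x) * v x = -(1 / 2) * ∫ x in Ω, weakDiv Db x * v x * v x := by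
  have : IsFiniteMeasure (volume.restrict Ω) := isFiniteMeasure_restrict.2
    ((measure_mono subset_closure).trans_lt hΩ.isCompact_closure.measure_lt_top).ne
  have hdiv : MemLp (weakDiv Db) ∞ (volume.restrict Ω) :=
    memLp_finsetSum _ fun i _ => (hb.2 i).1.eval_piLp i
  have hsmul : ∀ {E : Type} [NormedAddCommGroup E] [NormedSpace ℝ E] {f : Euc d → ℝ}
      {F : Euc d → E}, MemLp f 2 (volume.restrict Ω) → MemLp F ∞ (volume.restrict Ω) →
      MemLp (f • F) 2 (volume.restrict Ω) := fun hf hF => hF.smul hf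
  have hsmul_lim : ∀ {E : Type} [NormedAddCommGroup E] [NormedSpace ℝ E] {F : Euc d → E},
      MemLp F ∞ (volume.restrict Ω) →
      Tendsto (fun n => eLpNorm (v • F - φ n • F) 2 (volume.restrict Ω)) atTop (𝓝 0) := by
    intro E _ _ F hF
    have h3 : Tendsto (fun n => eLpNorm (fun x => v x - φ n x) 2 (volume.restrict Ω) *
        eLpNorm F ∞ (volume.restrict Ω)) atTop (𝓝 0) := by
      simpa using ENNReal.Tendsto.mul_const h1 (Or.inr hF.2.ne)
    refine tendsto_of_tendsto_of_tendsto_of_le_of_le tendsto_const_nhds h3 (fun n => zero_le)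
      fun n => ?_
    dsimp only
    rw [← sub_smul]
    exact eLpNorm_smul_le_mul_eLpNorm (p := 2) (q := ∞) (r := 2) hF.1
      (hv.1.1.sub ((hφ n).memLp (q := 2)).1)
  -- the identity for test functions
  have htest : ∀ n, ∫ x in Ω, inner ℝ (gradient (φ n) x) ((φ n • b) x) =
      -(1 / 2) * ∫ x in Ω, inner ℝ (φ n x) ((φ n • weakDiv Db) x) := by
    intro n
    have hsq := (hφ n).mul (hφ n)
    have e := Finset.sum_congr rfl fun i (_ : i ∈ Finset.univ) => (hb.2 i).2 _ hsq i
    rw [Finset.sum_neg_distrib, ← integral_finsetSum, ← integral_finsetSum] at e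
    · have e1 : ∀ x, ∑ i, b x i * gradient (fun x => φ n x * φ n x) x i =
          2 * inner ℝ (gradient (φ n) x) ((φ n • b) x) := by
        intro x
        simp only [(hφ n).gradient_mul_self, PiLp.inner_apply, Finset.mul_sum, Pi.smul_apply',
          PiLp.smul_apply, smul_eq_mul, RCLike.inner_apply, conj_trivial]
        exact Finset.sum_congr rfl fun i _ => by ring
      have e2 : ∀ x, ∑ i, Db i x i * (φ n x * φ n x) =
          inner ℝ (φ n x) ((φ n • weakDiv Db) x) := by
        intro x
        simp only [weakDiv, Pi.smul_apply', smul_eq_mul, RCLike.inner_apply, conj_trivial]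
        rw [← Finset.sum_mul]
        ring
      simp only [e1, e2] at e
      rw [integral_const_mul] at e
      linarith
    · exact fun i _ => integrable_mul_of_memLp_two (((hb.2 i).1.eval_piLp i).mono_exponent le_top)
        hsq.memLp
    · exact fun i _ => integrable_mul_of_memLp_two ((hb.1.eval_piLp i).mono_exponent le_top)
        (hsq.memLp_gradient.eval_piLp i)
  have lim1 := tendsto_integral_inner hv.2.1 (hsmul hv.1 hb.1) (fun n => (hφ n).memLp_gradient)
    (fun n => hsmul (hφ n).memLp hb.1) h2 (hsmul_lim hb.1)
  have lim2 := tendsto_integral_inner hv.1 (hsmul hv.1 hdiv) (fun n => (hφ n).memLp)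
    (fun n => hsmul (hφ n).memLp hdiv) h1 (hsmul_lim hdiv)
  have heq := tendsto_nhds_unique lim1 ((lim2.const_mul (-(1 / 2))).congr fun n => (htest n).symm)
  convert heq using 2
  · funext x
    simp only [Pi.smul_apply', inner_smul_right, real_inner_comm]
    ring
  · congr 1
    funext x
    simp only [Pi.smul_apply', smul_eq_mul, RCLike.inner_apply, conj_trivial]
    ring

namespace FEMesh

variable {d : ℕ} {Ω : Set (Euc d)} {ι : Type*} [Fintype ι] (T : FEMesh Ω ι) {p : ℕ}

/-- The weak gradient of a finite element function is the classical one: integrate by parts against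
test functions supported in one element. -/
theorem grad_ae_eq_of_isH1 (hΩ : Bornology.IsBounded Ω) (hint : interior (closure Ω) = Ω)
    {u : C(closure Ω, ℝ)} (hu : u ∈ T.space p) {G : Euc d → Euc d} (hG : IsH1 Ω (extZero u) G) :
    G =ᵐ[volume.restrict Ω] grad u := by
  have hcell : ∀ e, ∀ᵐ x ∂(volume : Measure (Euc d)), x ∈ (T.cell e).inner → G x = grad u x := by
    intro e
    have hUΩ : (T.cell e).inner ⊆ Ω := (T.inner_subset_interior_closure e).trans hint.subset
    have hUc := hUΩ.trans subset_closure
    obtain ⟨C, hC⟩ := (T.cell e).exists_fderiv_le_of_mem_localSpace (hu e)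
    have hi : ∀ i, ∀ᵐ x ∂(volume : Measure (Euc d)),
        x ∈ (T.cell e).inner → G x i - grad u x i = 0 := by
      intro i
      have hg2 : MemLp (grad u) 2 (volume.restrict (T.cell e).inner) :=
        memLp_two_of_top hΩ hUc (T.memLp_top_grad hu)
      have hG2 : MemLp G 2 (volume.restrict (T.cell e).inner) :=
        memLp_top_restrict_mono hG.2.1 hUΩ
      have hu2 : MemLp (extZero u) 2 (volume.restrict (T.cell e).inner) :=
        memLp_two_of_top hΩ hUc (memLp_top_extZero hΩ u)
      have : IsFiniteMeasure (volume.restrict (T.cell e).inner) := isFiniteMeasure_restrict.2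
        ((measure_mono hUc).trans_lt hΩ.isCompact_closure.measure_lt_top).ne
      refine (T.cell e).isOpen_inner.ae_eq_zero_of_integral_contDiff_smul_eq_zero
        (IntegrableOn.locallyIntegrableOn
          (((hG2.eval_piLp i).sub (hg2.eval_piLp i)).integrable one_le_two)) ?_
      intro φ hφ1 hφ2 hφ3
      have hφ : IsTestFun (T.cell e).inner φ := ⟨hφ1, hφ2, hφ3⟩
      have hweak := hG.2.2 φ (hφ.mono hUΩ) i
      have hgφ : ∀ x, fderiv ℝ φ x (EuclideanSpace.single i 1) = gradient φ x i := fun x =>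
        (gradient_apply φ x i).symm
      have hgu : ∀ x, fderiv ℝ (extZero u) x (EuclideanSpace.single i 1) = grad u x i := fun x =>
        (gradient_apply (extZero u) x i).symm
      -- the integrands vanish outside the element
      have hset : ∀ {f : Euc d → ℝ} {A : Set (Euc d)}, (∀ x ∉ (T.cell e).inner, f x = 0) →
          (T.cell e).inner ⊆ A → ∫ x in A, f x = ∫ x, f x := fun hf hA =>
        setIntegral_eq_integral_of_forall_compl_eq_zero fun x hx => hf x fun h => hx (hA h)
      have hintg : ∀ {f : Euc d → ℝ}, (∀ x ∉ (T.cell e).inner, f x = 0) →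
          Integrable f (volume.restrict (T.cell e).inner) → Integrable f := fun hf h =>
        (integrableOn_iff_integrable_of_support_subset fun x hx =>
          by_contra fun h' => hx (hf x h')).1 h
      have z1 : ∀ x ∉ (T.cell e).inner, extZero u x * gradient φ x i = 0 := fun x hx => by
        simp [hφ.gradient_of_notMem hx]
      have z2 : ∀ {F : Euc d → Euc d}, ∀ x ∉ (T.cell e).inner, F x i * φ x = 0 := fun x hx => by
        simp [hφ.eq_zero_of_notMem hx]
      have z3 : ∀ x ∉ (T.cell e).inner, extZero u x * φ x = 0 := fun x hx => by
        simp [hφ.eq_zero_of_notMem hx]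
      have i1 := hintg z1
        (integrable_mul_of_memLp_two hu2 (hφ.memLp_gradient.eval_piLp i))
      have i2 : Integrable fun x => G x i * φ x :=
        hintg z2 (integrable_mul_of_memLp_two (hG2.eval_piLp i) hφ.memLp)
      have i3 : Integrable fun x => grad u x i * φ x :=
        hintg z2 (integrable_mul_of_memLp_two (hg2.eval_piLp i) hφ.memLp)
      have i4 := hintg z3 (integrable_mul_of_memLp_two hu2 hφ.memLp)
      have hparts := integral_mul_fderiv_eq_neg_fderiv_mul_of_integrable (μ := volume)
        (f := extZero u) (g := φ) (v := EuclideanSpace.single i (1 : ℝ))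
        (by simpa only [hgu] using i3) (by simpa only [hgφ] using i1) i4
        (fun x hx => (hC x (hφ.2.2 hx)).1) (fun x _ => hφ.differentiable x)
      simp only [hgu, hgφ] at hparts
      rw [hset z1 hUΩ, hset z2 hUΩ, hparts, neg_inj] at hweak
      have : ∀ x, φ x • (G x i - grad u x i) = G x i * φ x - grad u x i * φ x := fun x => by
        rw [smul_eq_mul]; ring
      simp only [this]
      rw [integral_sub i2 i3, hweak, sub_self]
    filter_upwards [ae_all_iff.2 hi] with x hx hxe
    ext i
    exact sub_eq_zero.1 (hx i hxe)
  filter_upwards [ae_restrict_of_ae_restrict_of_subset subset_closure T.ae_exists_mem_inner,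
    ae_restrict_of_ae (ae_all_iff.2 hcell)] with x ⟨e, he⟩ hx
  exact hx e he

/-- On a patch, the classical gradient of a function in `V_{h,0}` is its weak gradient. -/
theorem isH1_patch (hΩ : Bornology.IsBounded Ω) (hint : interior (closure Ω) = Ω)
    {w : C(closure Ω, ℝ)} (hw : w ∈ T.space0 p) (e : ι) :
    IsH1 (T.patch e) (extZero w) (grad w) := by
  obtain ⟨hws, G, hG, -⟩ := hw
  have hsub : T.patch e ⊆ Ω := (T.patch_subset_interior_closure e).trans hint.subset
  have hae := T.grad_ae_eq_of_isH1 hΩ hint hws hG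
  refine ⟨memLp_top_restrict_mono hG.1 hsub,
    memLp_two_of_top hΩ (hsub.trans subset_closure) (T.memLp_top_grad hws), fun φ hφ i => ?_⟩
  have hset : ∀ {f : Euc d → ℝ}, (∀ x ∉ T.patch e, f x = 0) →
      ∫ x in T.patch e, f x = ∫ x in Ω, f x := by
    intro f hf
    rw [setIntegral_eq_integral_of_forall_compl_eq_zero hf,
      setIntegral_eq_integral_of_forall_compl_eq_zero fun x hx => hf x fun h => hx (hsub h)]
  rw [hset fun x hx => by simp [hφ.gradient_of_notMem hx],
    hset fun x hx => by simp [hφ.eq_zero_of_notMem hx], hG.2.2 φ (hφ.mono hsub) i]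
  congr 1
  apply integral_congr_ae
  filter_upwards [hae] with x hx
  rw [hx]

/-! ### Coercivity -/

variable {sel : Euc d → ι}

theorem stabConst_nonneg (e : ι) : 0 ≤ T.stabConst p sel e :=
  Real.sSup_nonneg fun _ hw => hw.1.le

theorem stabConst_le_one (e : ι) : T.stabConst p sel e ≤ 1 :=
  Real.sSup_le (fun _ hw => hw.2.1) zero_le_one

/-- The bound that `ω_e` is made for: `ω_e ‖κ_e ∇w‖² ≤ ‖∇w‖²`. -/
theorem stabConst_mul_fluctForm_le (hΩ : Bornology.IsBounded Ω)
    (hint : interior (closure Ω) = Ω) {w : C(closure Ω, ℝ)} (hw : w ∈ T.space0 p) (e : ι) :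
    T.stabConst p sel e * T.fluctForm p sel e w w ≤ innerL2 (T.patch e) (grad w) (grad w) := by
  rw [fluctForm, innerL2_self, innerL2_self]
  set x := normL2 (T.cell e).pts (T.fluct p sel (grad w))
  set y := normL2 (T.patch e) (grad w)
  have hx : 0 ≤ x := Real.sqrt_nonneg _
  rcases hx.eq_or_lt with hx0 | hx0
  · rw [← hx0]
    simp only [ne_eq, OfNat.ofNat_ne_zero, not_false_eq_true, zero_pow, mul_zero]
    positivity
  rw [← le_div_iff₀ (by positivity)]
  refine Real.sSup_le ?_ (by positivity)
  rintro t ⟨ht0, -, ht⟩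
  have h := ht _ le_rfl (extZero w) (grad w)
    (memLp_two_of_top hΩ subset_closure (T.memLp_top_grad hw.1)) (T.isH1_patch hΩ hint hw e)
  rw [le_div_iff₀ (by positivity)]
  have hs : 0 < √t := Real.sqrt_pos.2 ht0
  have h' : √t * x ≤ y := by
    rw [one_div, inv_mul_eq_div, le_div_iff₀ hs] at h
    linarith
  calc t * x ^ 2 = (√t * x) ^ 2 := by rw [mul_pow, Real.sq_sqrt ht0.le]
    _ ≤ y ^ 2 := by gcongr

theorem visc_nonneg (b : Euc d → Euc d) (e : ι) : 0 ≤ T.visc p b e := by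
  unfold visc
  have := Metric.diam_nonneg (s := (T.cell e).pts)
  positivity

theorem fluctForm_self_nonneg (e : ι) (w : C(closure Ω, ℝ)) : 0 ≤ T.fluctForm p sel e w w := by
  rw [fluctForm, innerL2_self]
  positivity

theorem stabForm_self_nonneg (b : Euc d → Euc d) (w : C(closure Ω, ℝ)) :
    0 ≤ T.stabForm p sel b w w :=
  Finset.sum_nonneg fun e _ => mul_nonneg
    (mul_nonneg (T.stabConst_nonneg e) (T.visc_nonneg b e)) (T.fluctForm_self_nonneg e w)

/-- A function of `V_{h,0}` with nonpositive energy vanishes. -/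
theorem eq_zero_of_cdrForm_nonpos (hΩo : IsOpen Ω) (hΩ : Bornology.IsBounded Ω)
    (hint : interior (closure Ω) = Ω) {ε σ₀ : ℝ} (hε : 0 < ε) (hσ₀ : 0 < σ₀)
    {b : Euc d → Euc d} {Db : Fin d → Euc d → Euc d} (hb : IsW1inf Ω b Db)
    {c : Euc d → ℝ} (hc : MemLp c ∞ (volume.restrict Ω))
    (hσ : ∀ᵐ x ∂volume.restrict Ω, σ₀ ≤ c x - 1 / 2 * weakDiv Db x)
    {w : C(closure Ω, ℝ)} (hw : w ∈ T.space0 p) (hle : cdrForm ε b c w w ≤ 0) : w = 0 := by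
  obtain ⟨hws, G, hG, φ, hφ, h1, h2⟩ := hw
  have hconv := integral_convection_of_isH10 hΩ hb hG hφ h1 h2
  have hconv' : ∫ x in Ω, inner ℝ (b x) (grad w x) * extZero w x =
      ∫ x in Ω, inner ℝ (b x) (G x) * extZero w x := by
    apply integral_congr_ae
    filter_upwards [T.grad_ae_eq_of_isH1 hΩ hint hws hG] with x hx
    rw [hx]
  have hdiv : MemLp (weakDiv Db) ∞ (volume.restrict Ω) :=
    memLp_finsetSum _ fun i _ => (hb.2 i).1.eval_piLp i
  have hw2 := hG.1
  have hsq : ∀ {f : Euc d → ℝ}, MemLp f ∞ (volume.restrict Ω) →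
      Integrable (fun x => f x * extZero w x * extZero w x) (volume.restrict Ω) := fun hf =>
    integrable_mul_of_memLp_two (hw2.mul hf) hw2
  have hww : Integrable (fun x => extZero w x * extZero w x) (volume.restrict Ω) :=
    integrable_mul_of_memLp_two hw2 hw2
  have hlow : σ₀ * ∫ x in Ω, extZero w x * extZero w x ≤
      ∫ x in Ω, (c x * extZero w x * extZero w x -
        1 / 2 * (weakDiv Db x * extZero w x * extZero w x)) := by
    rw [← integral_const_mul]
    refine integral_mono_ae (hww.const_mul _) ((hsq hc).sub ((hsq hdiv).const_mul _)) ?_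
    filter_upwards [hσ] with x hx
    have := mul_le_mul_of_nonneg_right hx (mul_self_nonneg (extZero w x))
    linarith
  rw [integral_sub (hsq hc) ((hsq hdiv).const_mul _), integral_const_mul] at hlow
  have hnn : 0 ≤ ε * innerL2 Ω (grad w) (grad w) := by
    rw [innerL2_self]
    positivity
  have hnn2 : 0 ≤ ∫ x in Ω, extZero w x * extZero w x :=
    integral_nonneg fun x => mul_self_nonneg _
  have hzero : ∫ x in Ω, extZero w x * extZero w x = 0 := by
    rw [cdrForm, hconv', hconv] at hle
    refine le_antisymm ?_ hnn2
    by_contra! hcon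
    have := mul_pos hσ₀ hcon
    linarith
  have hae := (integral_eq_zero_iff_of_nonneg (fun x => mul_self_nonneg _) hww).1 hzero
  have hcont : ContinuousOn (extZero w) (closure Ω) := continuousOn_extZero w
  have hΩ0 : EqOn (extZero w) 0 Ω := by
    refine Measure.eqOn_open_of_ae_eq (μ := volume) ?_ hΩo (hcont.mono subset_closure)
      continuousOn_const
    filter_upwards [hae] with x hx
    exact mul_self_eq_zero.1 hx
  ext x
  have := hΩ0.of_subset_closure hcont continuousOn_const subset_closure le_rfl x.2
  rwa [extZero_apply w x.2] at this

end FEMesh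

/-! ### The discrete problem -/

namespace FEMesh

variable {d : ℕ} {Ω : Set (Euc d)} {ι : Type*} [Fintype ι] (T : FEMesh Ω ι) {p : ℕ}
  {sel : Euc d → ι}

theorem integrable_convection (hΩ : Bornology.IsBounded Ω) {b : Euc d → Euc d}
    (hb : MemLp b ∞ (volume.restrict Ω)) {u : C(closure Ω, ℝ)} (hu : u ∈ T.space p)
    (v : C(closure Ω, ℝ)) :
    Integrable (fun x => inner ℝ (b x) (grad u x) * extZero v x) (volume.restrict Ω) := by
  have : IsFiniteMeasure (volume.restrict Ω) := isFiniteMeasure_restrict.2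
    ((measure_mono subset_closure).trans_lt hΩ.isCompact_closure.measure_lt_top).ne
  have hg := memLp_two_of_top hΩ subset_closure (T.memLp_top_grad hu)
  have hv := memLp_top_restrict_mono (memLp_top_extZero hΩ v) subset_closure
  refine (integrable_inner_of_memLp_two (hb.mono_exponent le_top)
    (MemLp.smul (p := ∞) (q := 2) (r := 2) hg hv)).congr (.of_forall fun x => ?_)
  simp only [Pi.smul_apply', inner_smul_right]
  ring

theorem integrable_reaction (hΩ : Bornology.IsBounded Ω) {c : Euc d → ℝ}
    (hc : MemLp c ∞ (volume.restrict Ω)) (u v : C(closure Ω, ℝ)) :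
    Integrable (fun x => c x * extZero u x * extZero v x) (volume.restrict Ω) :=
  integrable_mul_of_memLp_two
    ((memLp_two_of_top hΩ subset_closure (memLp_top_extZero hΩ u)).mul hc)
    (memLp_two_of_top hΩ subset_closure (memLp_top_extZero hΩ v))

theorem cdrForm_add_smul_left (hΩ : Bornology.IsBounded Ω) (ε : ℝ) {b : Euc d → Euc d}
    (hb : MemLp b ∞ (volume.restrict Ω)) {c : Euc d → ℝ} (hc : MemLp c ∞ (volume.restrict Ω))
    {u u' v : C(closure Ω, ℝ)} (hu : u ∈ T.space p) (hu' : u' ∈ T.space p) (hv : v ∈ T.space p)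
    (k : ℝ) :
    cdrForm ε b c (u + k • u') v = cdrForm ε b c u v + k * cdrForm ε b c u' v := by
  have h1 : ∫ x in Ω, inner ℝ (b x) (grad (u + k • u') x) * extZero v x =
      (∫ x in Ω, inner ℝ (b x) (grad u x) * extZero v x) +
        k * ∫ x in Ω, inner ℝ (b x) (grad u' x) * extZero v x := by
    rw [← integral_const_mul, ← integral_add (T.integrable_convection hΩ hb hu v)
      ((T.integrable_convection hΩ hb hu' v).const_mul k)]
    apply integral_congr_ae
    filter_upwards [ae_restrict_of_ae_restrict_of_subset subset_closure
      (T.grad_add_smul_ae hu hu' k)] with x hx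
    rw [hx, Pi.add_apply, Pi.smul_apply, inner_add_right, inner_smul_right]
    ring
  have h2 : ∫ x in Ω, c x * extZero (u + k • u') x * extZero v x =
      (∫ x in Ω, c x * extZero u x * extZero v x) +
        k * ∫ x in Ω, c x * extZero u' x * extZero v x := by
    rw [← integral_const_mul, ← integral_add (integrable_reaction hΩ hc u v)
      ((integrable_reaction hΩ hc u' v).const_mul k)]
    refine integral_congr_ae (.of_forall fun x => ?_)
    simp only [extZero_add_smul, Pi.add_apply, Pi.smul_apply, smul_eq_mul]
    ring
  unfold cdrForm
  rw [T.innerL2_grad_add_smul_left hΩ subset_closure hu hu' hv, h1, h2]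
  ring

theorem cdrForm_add_smul_right (hΩ : Bornology.IsBounded Ω) (ε : ℝ) {b : Euc d → Euc d}
    (hb : MemLp b ∞ (volume.restrict Ω)) {c : Euc d → ℝ} (hc : MemLp c ∞ (volume.restrict Ω))
    {u v v' : C(closure Ω, ℝ)} (hu : u ∈ T.space p) (hv : v ∈ T.space p) (hv' : v' ∈ T.space p)
    (k : ℝ) :
    cdrForm ε b c u (v + k • v') = cdrForm ε b c u v + k * cdrForm ε b c u v' := by
  have h1 : ∫ x in Ω, inner ℝ (b x) (grad u x) * extZero (v + k • v') x =
      (∫ x in Ω, inner ℝ (b x) (grad u x) * extZero v x) +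
        k * ∫ x in Ω, inner ℝ (b x) (grad u x) * extZero v' x := by
    rw [← integral_const_mul, ← integral_add (T.integrable_convection hΩ hb hu v)
      ((T.integrable_convection hΩ hb hu v').const_mul k)]
    refine integral_congr_ae (.of_forall fun x => ?_)
    simp only [extZero_add_smul, Pi.add_apply, Pi.smul_apply, smul_eq_mul]
    ring
  have h2 : ∫ x in Ω, c x * extZero u x * extZero (v + k • v') x =
      (∫ x in Ω, c x * extZero u x * extZero v x) +
        k * ∫ x in Ω, c x * extZero u x * extZero v' x := by
    rw [← integral_const_mul, ← integral_add (integrable_reaction hΩ hc u v)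
      ((integrable_reaction hΩ hc u v').const_mul k)]
    refine integral_congr_ae (.of_forall fun x => ?_)
    simp only [extZero_add_smul, Pi.add_apply, Pi.smul_apply, smul_eq_mul]
    ring
  unfold cdrForm
  rw [innerL2_comm, T.innerL2_grad_add_smul_left hΩ subset_closure hv hv' hu, h1, h2,
    innerL2_comm Ω (grad v), innerL2_comm Ω (grad v')]
  ring

variable (p sel)

/-- The two stabilization terms together, with the blending factors frozen at `t`. -/
noncomputable def frozenStab (b : Euc d → Euc d) (t : ι → ℝ) (w v : C(closure Ω, ℝ)) : ℝ :=
  T.stabForm p sel b w v + T.nonlinForm p sel b (fun e _ => t e) 0 w v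

variable {p sel}

theorem frozenStab_comm (b : Euc d → Euc d) (t : ι → ℝ) (w v : C(closure Ω, ℝ)) :
    T.frozenStab p sel b t w v = T.frozenStab p sel b t v w := by
  unfold frozenStab stabForm nonlinForm
  simp only [T.fluctForm_comm _ v w, innerL2_comm _ (grad v) (grad w)]

theorem frozenStab_add_smul_right (hΩ : Bornology.IsBounded Ω) (b : Euc d → Euc d) (t : ι → ℝ)
    {w v v' : C(closure Ω, ℝ)} (hw : w ∈ T.space p) (hv : v ∈ T.space p) (hv' : v' ∈ T.space p)
    (k : ℝ) : T.frozenStab p sel b t w (v + k • v') =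
      T.frozenStab p sel b t w v + k * T.frozenStab p sel b t w v' := by
  unfold frozenStab stabForm nonlinForm
  simp only [T.fluctForm_add_smul_left hΩ _ hv hv' hw,
    T.innerL2_grad_add_smul_left hΩ (T.patch_subset_closure _) hv hv' hw]
  simp only [mul_add, Finset.mul_sum, ← Finset.sum_add_distrib]
  exact Finset.sum_congr rfl fun e _ => by ring

/-- The stabilization is dissipative: for every element, `(∇w, ∇w) - ω_e (κ_e ∇w, κ_e ∇w)` is
nonnegative by the choice of `ω_e`, and so is `1 - ω_e`. -/
theorem frozenStab_self_nonneg (hΩ : Bornology.IsBounded Ω) (hint : interior (closure Ω) = Ω)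
    (b : Euc d → Euc d) {t : ι → ℝ} (ht : t ∈ Icc (0 : ι → ℝ) 1) {w : C(closure Ω, ℝ)}
    (hw : w ∈ T.space0 p) : 0 ≤ T.frozenStab p sel b t w w := by
  refine add_nonneg (T.stabForm_self_nonneg b w) (add_nonneg ?_ ?_)
  · refine Finset.sum_nonneg fun e _ => mul_nonneg
      (mul_nonneg (sub_nonneg.2 (ht.2 e)) (T.visc_nonneg b e)) (sub_nonneg.2 ?_)
    exact T.stabConst_mul_fluctForm_le hΩ hint hw e
  · exact Finset.sum_nonneg fun e _ => mul_nonneg (mul_nonneg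
      (mul_nonneg (ht.1 e) (T.visc_nonneg b e)) (sub_nonneg.2 (T.stabConst_le_one e)))
      (T.fluctForm_self_nonneg e w)

/-- `V_{h,0}` as a subspace of `V_h`. -/
def subspace0 (p : ℕ) : Submodule ℝ (T.space p) where
  carrier := {u | IsH10 Ω (extZero (u : C(closure Ω, ℝ)))}
  add_mem' := by
    intro u v hu hv
    have h := extZero_add_smul u.1 v.1 1
    rw [one_smul] at h
    change IsH10 Ω (extZero (u.1 + v.1))
    rw [h]
    exact IsH10.add_smul hu hv 1
  zero_mem' := by
    have h : extZero (0 : C(closure Ω, ℝ)) = 0 := by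
      funext x
      by_cases hx : x ∈ closure Ω
      · exact extZero_apply 0 hx
      · exact extZero_of_notMem 0 hx
    change IsH10 Ω (extZero (0 : C(closure Ω, ℝ)))
    rw [h]
    exact isH10_zero
  smul_mem' := by
    intro c u hu
    have h : extZero (c • u.1) = 0 + c • extZero u.1 := by
      funext x
      by_cases hx : x ∈ closure Ω
      · simp [extZero_apply _ hx]
      · simp [extZero_of_notMem _ hx]
    change IsH10 Ω (extZero (c • u.1))
    rw [h]
    exact isH10_zero.add_smul hu c

end FEMesh

theorem mainTheorem3 {d : ℕ} (hd : 1 ≤ d) {Ω : Set (Euc d)} (hΩ_open : IsOpen Ω)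
    (hΩ_bdd : Bornology.IsBounded Ω) (hΩ_lip : HasLipschitzBoundary Ω)
    (ε σ₀ : ℝ) (hε : 0 < ε) (hσ₀ : 0 < σ₀)
    (b : Euc d → Euc d) (Db : Fin d → Euc d → Euc d) (hb : IsW1inf Ω b Db)
    (c : Euc d → ℝ) (hc : MemLp c ∞ (volume.restrict Ω))
    (hc_nonneg : ∀ᵐ x ∂volume.restrict Ω, 0 ≤ c x)
    (hσ : ∀ᵐ x ∂volume.restrict Ω, σ₀ ≤ c x - 1 / 2 * weakDiv Db x)
    (g : Euc d → ℝ) (hg : MemLp g 2 (volume.restrict Ω))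
    {ι : Type*} [Fintype ι] (T : FEMesh Ω ι) (p : ℕ) (hp : 1 ≤ p)
    (sel : Euc d → ι) (hsel : ∀ a ∈ T.nodes p, a ∈ (T.cell (sel a)).pts)
    (γ : ι → T.space p → ℝ) (hγ_range : ∀ e u, γ e u ∈ Set.Icc (0 : ℝ) 1)
    (hγ_cont : ∀ e, Continuous (γ e))
    (uD : T.space p) :
    ∃ u : T.space p, (u - uD : C(closure Ω, ℝ)) ∈ T.space0 p ∧
      ∀ v ∈ T.space0 p,
        cdrForm ε b c (u : C(closure Ω, ℝ)) v + T.stabForm p sel b u v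
          + T.nonlinForm p sel b γ u u v = ∫ x in Ω, g x * extZero v x := by
  have hint : interior (closure Ω) = Ω := hΩ_lip.interior_closure hΩ_open
  have := T.finiteDimensional_space (p := p)
  have hB : ∀ t : ι → ℝ, ∃ B : T.space p →ₗ[ℝ] T.space p →ₗ[ℝ] ℝ, ∀ u v : T.space p,
      B u v = cdrForm ε b c u.1 v.1 + T.frozenStab p sel b t u.1 v.1 := by
    refine fun t => exists_bilinear_of_add_smul _ (fun u u' v k => ?_) (fun u v v' k => ?_)
    · change cdrForm ε b c (u.1 + k • u'.1) v.1 + T.frozenStab p sel b t (u.1 + k • u'.1) v.1 = _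
      rw [T.cdrForm_add_smul_left hΩ_bdd ε hb.1 hc u.2 u'.2 v.2, T.frozenStab_comm,
        T.frozenStab_add_smul_right hΩ_bdd b t v.2 u.2 u'.2, T.frozenStab_comm b t v.1 u.1,
        T.frozenStab_comm b t v.1 u'.1]
      ring
    · change cdrForm ε b c u.1 (v.1 + k • v'.1) + T.frozenStab p sel b t u.1 (v.1 + k • v'.1) = _
      rw [T.cdrForm_add_smul_right hΩ_bdd ε hb.1 hc u.2 v.2 v'.2,
        T.frozenStab_add_smul_right hΩ_bdd b t u.2 v.2 v'.2]
      ring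
  choose B hB using hB
  have hgi : ∀ v : C(closure Ω, ℝ), Integrable (fun x => g x * extZero v x) (volume.restrict Ω) :=
    fun v => integrable_mul_of_memLp_two hg
      (FEMesh.memLp_two_of_top hΩ_bdd subset_closure (memLp_top_extZero hΩ_bdd v))
  have hl : ∀ (v w : C(closure Ω, ℝ)) (k : ℝ), ∫ x in Ω, g x * extZero (v + k • w) x =
      (∫ x in Ω, g x * extZero v x) + k * ∫ x in Ω, g x * extZero w x := by
    intro v w k
    rw [← integral_const_mul, ← integral_add (hgi v) ((hgi w).const_mul k)]
    refine integral_congr_ae (.of_forall fun x => ?_)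
    simp only [extZero_add_smul, Pi.add_apply, Pi.smul_apply, smul_eq_mul]
    ring
  have hl0 : ∫ x in Ω, g x * extZero (0 : C(closure Ω, ℝ)) x = 0 := by
    have := hl 0 0 1
    simp only [smul_zero, add_zero, one_mul] at this
    linarith
  let l : T.space p →ₗ[ℝ] ℝ :=
    { toFun := fun v => ∫ x in Ω, g x * extZero v.1 x
      map_add' := fun v w => by simpa using hl v.1 w.1 1
      map_smul' := fun k w => by simpa [hl0] using hl 0 w.1 k }
  obtain ⟨u, hu, huv⟩ := exists_solution_of_frozen_definite (T.subspace0 p) B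
    (fun u v => by
      simp only [hB, FEMesh.frozenStab, FEMesh.nonlinForm]
      fun_prop)
    l γ hγ_range hγ_cont
    (fun t ht w hw h0 => by
      rw [hB] at h0
      have hw' : w.1 ∈ T.space0 p := ⟨w.2, hw⟩
      have hst := T.frozenStab_self_nonneg (sel := sel) hΩ_bdd hint b ht hw'
      exact Subtype.ext (T.eq_zero_of_cdrForm_nonpos hΩ_open hΩ_bdd hint hε hσ₀ hb hc hσ hw'
        (by linarith)))
    uD
  refine ⟨u, ⟨(u - uD).2, hu⟩, fun v hv => ?_⟩
  have h := huv ⟨v, hv.1⟩ hv.2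
  rw [hB] at h
  rw [add_assoc]
  exact h
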